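/- **Reciprocity of the Green's function.** Points of $\mathbb R^2$ are written $(z,x)$. Let $D>0$, $L\in\mathbb R$, and let $\Omega\subset\mathbb R^2$ be a terminating waveguide: a connected open set with $\Omega\cap\{z<L\}=(-\infty,L)\times(0,D)$ and with $\Omega\cap\{z\ge L\}$ bounded. Let the wave speed $c$ be measurable on $\Omega$, bounded below by a positive constant, and equal to a constant $c_0>0$ at all points of $\Omega$ with $z\le L$; put $\eta=c_0^2/c^2$ and $k=\omega/c_0$ with $\omega\in\mathbb R$. For $n\ge 0$ put $\mu_n=(n\pi/D)^2$ and for $n\ge1$ put $X_n(x)=\sqrt{2/D}\,\sin(\sqrt{\mu_n}\,x)$. Assume $\mu_M<k^2<\mu_{M+1}$ for some integer $M\ge 0$, and let $\beta_n=\sqrt{k^2-\mu_n}$ for $1\le n\le M$ and $\beta_n=i\sqrt{\mu_n-k^2}$ for $n\ge M+1$. Let $z_a<L$, $\mathcal A=\{z_a\}\times(0,D)$ and $\Omega_{\mathcal A}=\Omega\cap\{z>z_a\}$, with outward unit normal $\nu=(-1,0)$ on $\mathcal A$. The Dirichlet-to-Neumann map on $\mathcal A$ is $$Tu=\sum_{n\ge1}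 i\beta_n\,u_n(z_a)\,X_n,\qquad u_n(z)=\int_0^D u(z,x)X_n(x)\,dx .$$ Assume that for every $y\in\Omega_{\mathcal A}$ the problem with a point source at $y$ has a solution $G(\cdot,y)$, in the following sense: $G(\cdot,y)$ is a complex-valued function, locally integrable in $\Omega_{\mathcal A}$ and $C^1$ on $(\Omega_{\mathcal A}\cup\mathcal A)\setminus\{y\}$, such that 1. $-\Delta G(\cdot,y)-k^2\eta\,G(\cdot,y)=\delta(\cdot-y)$ in $\Omega_{\mathcal A}$, in the sense of distributions; 2. $G(\cdot,y)=0$ on the walls $\partial\Omega_{\mathcal A}\setminus\mathcal A$, in the $H^1$ sense: outside each neighbourhood of $y$, $G(\cdot,y)$ is a limit in $H^1$ of restrictions to $\Omega_{\mathcal A}$ of functions in $C_c^\infty(\Omega)$; 3. $\partial_\nu G(\cdot,y)=T\,G(\cdot,y)$ on $\mathcal A$, where the trace of $G(\cdot,y)$ on $\mathcal A$ is square integrable and the series converges in $L^2(0,D)$. Then $G(x_1,x_2)=G(x_2,x_1)$ for all $x_1,x_2\in\Omega_{\mathcal A}$. -/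

import Mathlib

open Set Filter Topology MeasureTheory
open scoped ContDiff ENNReal

noncomputable section

/-- A two-dimensional terminating waveguide. Points of the plane are pairs `(z, x)`, with `z` the
range and `x` the cross-range. The region `Ω` is the semi-infinite strip `(-∞, L) × (0, D)`
continued by a bounded part in `L ≤ z`. The wave speed `c` equals the constant `c₀` for `z ≤ L`. -/
structure TerminatingWaveguide where
  /-- width of the strip -/
  D : ℝ
  /-- range up to which the waveguide is a homogeneous strip -/
  L : ℝ
  /-- the region occupied by the waveguide -/
  Ω : Set (ℝ × ℝ)
  /-- reference wave speed -/
  c₀ : ℝ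
  /-- wave speed (only its values on `Ω` matter) -/
  c : ℝ × ℝ → ℝ
  D_pos : 0 < D
  isOpen_Ω : IsOpen Ω
  isConnected_Ω : IsConnected Ω
  strip_eq : Ω ∩ {p | p.1 < L} = Iio L ×ˢ Ioo 0 D
  isBounded_end : Bornology.IsBounded (Ω ∩ {p | L ≤ p.1})
  c₀_pos : 0 < c₀
  measurable_c : Measurable c
  c_lower : ∃ m : ℝ, 0 < m ∧ ∀ p ∈ Ω, m ≤ c p
  c_eq : ∀ p ∈ Ω, p.1 ≤ L → c p = c₀

/-- Partial derivative in range, `∂u/∂z`. -/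
def partialZ (u : ℝ × ℝ → ℂ) (p : ℝ × ℝ) : ℂ := deriv (fun s : ℝ => u (s, p.2)) p.1

/-- Partial derivative in cross-range, `∂u/∂x`. -/
def partialX (u : ℝ × ℝ → ℂ) (p : ℝ × ℝ) : ℂ := deriv (fun s : ℝ => u (p.1, s)) p.2

/-- The Laplacian in the plane. -/
def laplacianZX (u : ℝ × ℝ → ℂ) (p : ℝ × ℝ) : ℂ :=
  partialZ (partialZ u) p + partialX (partialX u) p

/-- `φ` is a complex test function on `U`, that is, `φ ∈ C_c^∞(U)`. -/
def IsTestFunction (U : Set (ℝ × ℝ)) (φ : ℝ × ℝ → ℂ) : Prop :=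
  ContDiff ℝ ∞ φ ∧ HasCompactSupport φ ∧ tsupport φ ⊆ U

/-- The square of the `H¹(S)` norm of `u - v`. -/
def sobolevDistSq (S : Set (ℝ × ℝ)) (u v : ℝ × ℝ → ℂ) : ℝ≥0∞ :=
  ∫⁻ p in S, (‖u p - v p‖ₑ ^ 2 + ‖partialZ u p - partialZ v p‖ₑ ^ 2
    + ‖partialX u p - partialX v p‖ₑ ^ 2)

namespace TerminatingWaveguide

variable (W : TerminatingWaveguide)

/-- The (real) wavenumber `k = freq / c₀` at the angular frequency `freq`. -/
def k (freq : ℝ) : ℝ := freq / W.c₀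

/-- The index of refraction `η = c₀² / c²`. -/
def η (p : ℝ × ℝ) : ℝ := W.c₀ ^ 2 / W.c p ^ 2

/-- Eigenvalues `μ_n = (n π / D)²` of `-d²/dx²` on `(0, D)` with Dirichlet conditions. -/
def μ (n : ℕ) : ℝ := (n * Real.pi / W.D) ^ 2

/-- Orthonormal eigenfunctions `X_n(x) = √(2/D) sin(√μ_n x)`. -/
def X (n : ℕ) (x : ℝ) : ℝ := Real.sqrt (2 / W.D) * Real.sin (Real.sqrt (W.μ n) * x)

/-- Horizontal wavenumbers, where `M` is the number of propagating modes. -/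
def β (freq : ℝ) (M n : ℕ) : ℂ :=
  if n ≤ M then (Real.sqrt (W.k freq ^ 2 - W.μ n) : ℂ)
  else Complex.I * (Real.sqrt (W.μ n - W.k freq ^ 2) : ℂ)

/-- The truncated waveguide: the part of `Ω` to the right of the artificial boundary
`{za} × (0, D)`, as an open set. -/
def truncated (za : ℝ) : Set (ℝ × ℝ) := W.Ω ∩ {p | za < p.1}

/-- The truncated waveguide together with the open segment `{za} × (0, D)`. -/
def truncatedWithA (za : ℝ) : Set (ℝ × ℝ) := W.Ω ∩ {p | za ≤ p.1}

/-- Fourier coefficient `u_n(z) = ∫₀ᴰ u(z, x) X_n(x) dx`. -/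
def coeff (u : ℝ × ℝ → ℂ) (n : ℕ) (z : ℝ) : ℂ :=
  ∫ x in (0 : ℝ)..W.D, u (z, x) * (W.X n x : ℂ)

/-- `T u = f` on the artificial boundary at `za`, where `T u = ∑_{n ≥ 1} i β_n u_n(za) X_n` is the
Dirichlet-to-Neumann map: the trace `u(za, ·)` is in `L²(0, D)` and the series
converges to `f` in `L²(0, D)`. -/
def HasDtN (freq : ℝ) (M : ℕ) (za : ℝ) (u : ℝ × ℝ → ℂ) (f : ℝ → ℂ) : Prop :=
  MemLp (fun x : ℝ => u (za, x)) 2 (volume.restrict (Ioo 0 W.D)) ∧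
  Tendsto (fun N : ℕ => eLpNorm
      (fun x : ℝ => f x - ∑ n ∈ Finset.Icc 1 N,
        Complex.I * W.β freq M n * W.coeff u n za * (W.X n x : ℂ))
      2 (volume.restrict (Ioo 0 W.D)))
    atTop (𝓝 0)

/-- The outward normal derivative on the artificial boundary at `za`. The outward unit normal of
the truncated waveguide is `(-1, 0)`, and the derivative is taken from inside. -/
def normalDerivA (za : ℝ) (u : ℝ × ℝ → ℂ) (x : ℝ) : ℂ :=
  -derivWithin (fun z : ℝ => u (z, x)) (Ici za) za

/-- `u` solves the boundary value problem for a point source at `xs` in the truncated waveguide.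
The restrictions to the truncated waveguide of functions in `C_c^∞(Ω)` vanish near the walls and
are unrestricted on the artificial boundary, so their `H¹` limits are the `H¹` functions whose
trace on the walls is zero. -/
structure SolvesPointSource (freq : ℝ) (M : ℕ) (za : ℝ) (xs : ℝ × ℝ) (u : ℝ × ℝ → ℂ) : Prop where
  /-- `u` is continuously differentiable away from the source, up to the artificial boundary. -/
  contDiffOn : ContDiffOn ℝ 1 u (W.truncatedWithA za \ {xs})
  /-- `u` is locally integrable, the source included. -/
  locallyIntegrableOn : LocallyIntegrableOn u (W.truncated za)
  /-- `-Δu - k² η u = δ(· - xs)` in the sense of distributions. -/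
  helmholtz : ∀ φ : ℝ × ℝ → ℂ, IsTestFunction (W.truncated za) φ →
    ∫ p in W.truncated za,
      u p * (-laplacianZX φ p - ((W.k freq ^ 2 * W.η p : ℝ) : ℂ) * φ p) = φ xs
  /-- Away from the source `u` is in `H¹` and it vanishes on the walls in the sense of traces. -/
  dirichlet : ∀ r : ℝ, 0 < r → ∀ ε : ℝ≥0∞, 0 < ε → ∃ v : ℝ × ℝ → ℂ, IsTestFunction W.Ω v ∧
    sobolevDistSq (W.truncated za \ Metric.ball xs r) u v < ε
  /-- `∂u/∂ν = T u` on the artificial boundary. -/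
  radiation : W.HasDtN freq M za u (normalDerivA za u)

/-- `G(·, xs)` solves the point source problem for every source `xs` in the truncated waveguide. -/
def IsGreensFunction (freq : ℝ) (M : ℕ) (za : ℝ) (G : ℝ × ℝ → ℝ × ℝ → ℂ) : Prop :=
  ∀ xs ∈ W.truncated za, W.SolvesPointSource freq M za xs (fun p => G p xs)

end TerminatingWaveguide

end

/-! ### Directional derivatives of functions on the plane -/

/-! Write u and v for the solutions with sources x₁ and x₂, and κ = k²η. The theorem is Green's
second identity for u and v: the sources contribute v(x₁) - u(x₂), the walls contribute nothing, and
the artificial boundary contributes nothing because the Dirichlet-to-Neumann map is symmetric for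
the bilinear pairing. Since κ is only measurable and bounded, the walls are arbitrary and the
singularities are not given explicitly, all boundary terms at the sources and walls are replaced by
integrals against cutoffs.

At the sources: let χ₁ be a cutoff equal to 1 near x₁ and supported away from x₂. The function vχ₁
is too rough to be a test function in the equation of u, but it is continuous with bounded
distributional Laplacian vΔχ₁ + 2∇v·∇χ₁ - κvχ₁, so it is admissible after mollification
(`integral_helmholtz_of_distributional_laplacian`). The κ terms cancel, and integration by parts
where ∇χ₁ lives gives v(x₁) = ∫ (v∇u - u∇v)·∇χ₁ (`IsPointSourceSolution.eq_integral_gradDot`). The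
same holds with the roles exchanged. Hence v(x₁) - u(x₂) = ∫ (v∇u - u∇v)·∇χ with χ = χ₁ + χ₂.

Away from the sources: the equation of v is tested with (1 - χ)φₙ, where the φₙ are the H¹
approximations of u given by the wall condition. Such functions need not vanish on the artificial
boundary, which produces the pairing of ∂v/∂ν with u there
(`SolvesPointSource.integral_gradDot_sub`, `SolvesPointSource.integral_cutoff_eq`). Exchanging u and
v and subtracting leaves ∫ (v∇u - u∇v)·∇χ on one side and the difference of the two boundary
pairings on the other. Both pairings equal ∑ iβₙuₙvₙ (`HasDtN.integral_mul_comm`), so the difference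
is zero. -/

theorem partialZ_eq_lineDeriv (u : ℝ × ℝ → ℂ) :
    partialZ u = fun p => lineDeriv ℝ u p (1, 0) := by
  funext p
  have h := deriv_comp_const_add (f := fun s : ℝ => u (s, p.2)) p.1 0
  simp only [add_zero] at h
  rw [partialZ, lineDeriv, ← h]
  congr 1
  funext t
  congr 1
  ext <;> simp

theorem partialX_eq_lineDeriv (u : ℝ × ℝ → ℂ) :
    partialX u = fun p => lineDeriv ℝ u p (0, 1) := by
  funext p
  have h := deriv_comp_const_add (f := fun s : ℝ => u (p.1, s)) p.2 0
  simp only [add_zero] at h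
  rw [partialX, lineDeriv, ← h]
  congr 1
  funext t
  congr 1
  ext <;> simp

/-- With directions in place of coordinates, each integration by parts is done once for an arbitrary
e and then used for both terms. -/
theorem laplacianZX_eq_lineDeriv (u : ℝ × ℝ → ℂ) (p : ℝ × ℝ) :
    laplacianZX u p = lineDeriv ℝ (fun q => lineDeriv ℝ u q (1, 0)) p (1, 0)
      + lineDeriv ℝ (fun q => lineDeriv ℝ u q (0, 1)) p (0, 1) := by
  simp only [laplacianZX, partialZ_eq_lineDeriv, partialX_eq_lineDeriv]

section LineDeriv

variable {f g : ℝ × ℝ → ℂ} {p : ℝ × ℝ} (e : ℝ × ℝ)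

theorem lineDeriv_mul (hf : DifferentiableAt ℝ f p) (hg : DifferentiableAt ℝ g p) :
    lineDeriv ℝ (fun q => f q * g q) p e
      = f p * lineDeriv ℝ g p e + lineDeriv ℝ f p e * g p := by
  rw [(hf.fun_mul hg).lineDeriv_eq_fderiv, hf.lineDeriv_eq_fderiv, hg.lineDeriv_eq_fderiv,
    fderiv_fun_mul hf hg]
  simp [mul_comm]

theorem lineDeriv_add' (hf : DifferentiableAt ℝ f p) (hg : DifferentiableAt ℝ g p) :
    lineDeriv ℝ (fun q => f q + g q) p e = lineDeriv ℝ f p e + lineDeriv ℝ g p e := by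
  rw [(hf.fun_add hg).lineDeriv_eq_fderiv, hf.lineDeriv_eq_fderiv, hg.lineDeriv_eq_fderiv,
    fderiv_fun_add hf hg]
  simp

theorem lineDeriv_sub' (hf : DifferentiableAt ℝ f p) (hg : DifferentiableAt ℝ g p) :
    lineDeriv ℝ (fun q => f q - g q) p e = lineDeriv ℝ f p e - lineDeriv ℝ g p e := by
  rw [(hf.fun_sub hg).lineDeriv_eq_fderiv, hf.lineDeriv_eq_fderiv, hg.lineDeriv_eq_fderiv,
    fderiv_fun_sub hf hg]
  simp

theorem lineDeriv_of_eventuallyEq_const {a : ℂ} (h : f =ᶠ[𝓝 p] fun _ => a) :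
    lineDeriv ℝ f p e = 0 := by
  rw [h.lineDeriv_eq]
  simp [lineDeriv]

theorem tsupport_lineDeriv_subset : tsupport (fun q => lineDeriv ℝ f q e) ⊆ tsupport f := by
  apply closure_minimal _ (isClosed_tsupport f)
  intro q hq
  by_contra h
  exact hq (lineDeriv_of_eventuallyEq_const e (a := 0) (notMem_tsupport_iff_eventuallyEq.1 h))

theorem ContDiff.lineDeriv_eq_fderiv {n : WithTop ℕ∞} (hf : ContDiff ℝ n f) (hn : n ≠ 0) :
    (fun q => lineDeriv ℝ f q e) = fun q => fderiv ℝ f q e :=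
  funext fun q => (hf.differentiable hn q).lineDeriv_eq_fderiv

theorem ContDiff.lineDeriv_infty (hf : ContDiff ℝ ∞ f) :
    ContDiff ℝ ∞ fun q => lineDeriv ℝ f q e := by
  rw [hf.lineDeriv_eq_fderiv e (by simp)]
  exact (hf.fderiv_right (m := ∞) (by simp)).clm_apply contDiff_const

theorem ContDiff.continuous_lineDeriv {n : WithTop ℕ∞} (hf : ContDiff ℝ n f) (hn : n ≠ 0) :
    Continuous fun q => lineDeriv ℝ f q e := by
  rw [hf.lineDeriv_eq_fderiv e hn]
  exact (hf.continuous_fderiv hn).clm_apply continuous_const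

theorem ContDiffOn.continuousOn_lineDeriv {V : Set (ℝ × ℝ)} (hV : IsOpen V)
    (hf : ContDiffOn ℝ 1 f V) : ContinuousOn (fun q => lineDeriv ℝ f q e) V := by
  have h := (hf.continuousOn_fderiv_of_isOpen hV le_rfl).clm_apply (continuousOn_const (c := e))
  refine h.congr fun q hq => ?_
  exact ((hf.contDiffAt (hV.mem_nhds hq)).differentiableAt one_ne_zero).lineDeriv_eq_fderiv

end LineDeriv

/-! ### Products with compactly supported factors, and integration by parts -/

section Extension

variable {V : Set (ℝ × ℝ)} {f g : ℝ × ℝ → ℂ}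

theorem tsupport_mul_left_subset (f g : ℝ × ℝ → ℂ) :
    tsupport (fun q => f q * g q) ⊆ tsupport f :=
  closure_mono (Function.support_mul_subset_left f g)

theorem tsupport_mul_right_subset (f g : ℝ × ℝ → ℂ) :
    tsupport (fun q => f q * g q) ⊆ tsupport g :=
  closure_mono (Function.support_mul_subset_right f g)

/-- The product vanishes near every point outside `tsupport g`, so the values of f off V are
harmless. This allows integrals over the whole plane for solutions that are regular only in the open
set. -/
theorem ContinuousOn.continuous_mul_of_tsupport (hV : IsOpen V) (hf : ContinuousOn f V)
    (hg : Continuous g) (hgV : tsupport g ⊆ V) : Continuous fun q => f q * g q := by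
  refine continuous_of_tsupport fun q hq => ?_
  exact (hf.continuousAt (hV.mem_nhds (hgV (tsupport_mul_right_subset f g hq)))).mul
    hg.continuousAt

theorem ContDiffOn.contDiff_mul_of_tsupport {n : WithTop ℕ∞} (hV : IsOpen V)
    (hf : ContDiffOn ℝ n f V) (hg : ContDiff ℝ n g) (hgV : tsupport g ⊆ V) :
    ContDiff ℝ n fun q => f q * g q := by
  refine contDiff_iff_contDiffAt.2 fun q => ?_
  by_cases hq : q ∈ tsupport fun q => f q * g q
  swap
  · exact contDiffAt_const.congr_of_eventuallyEq (notMem_tsupport_iff_eventuallyEq.1 hq)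
  exact (hf.contDiffAt (hV.mem_nhds (hgV (tsupport_mul_right_subset f g hq)))).mul
    hg.contDiffAt

theorem ContinuousOn.integrable_mul_of_tsupport (hV : IsOpen V) (hf : ContinuousOn f V)
    (hg : Continuous g) (hgc : HasCompactSupport g) (hgV : tsupport g ⊆ V) :
    Integrable fun q => f q * g q :=
  (hf.continuous_mul_of_tsupport hV hg hgV).integrable_of_hasCompactSupport hgc.mul_left

/-- Integration by parts against a compactly supported `C¹` function. -/
theorem integral_mul_lineDeriv_of_tsupport (e : ℝ × ℝ) (hV : IsOpen V)
    (hf : ContDiffOn ℝ 1 f V) (hg : ContDiff ℝ 1 g) (hgc : HasCompactSupport g)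
    (hgV : tsupport g ⊆ V) :
    ∫ q, f q * lineDeriv ℝ g q e = -∫ q, lineDeriv ℝ f q e * g q := by
  have hg' := hg.continuous_lineDeriv e one_ne_zero
  have hs := tsupport_lineDeriv_subset (f := g) e
  have hgc' : HasCompactSupport fun q => lineDeriv ℝ g q e :=
    hgc.of_isClosed_subset (isClosed_tsupport _) hs
  refine integral_bilinear_hasLineDerivAt_right_eq_neg_left_of_integrable
    (B := ContinuousLinearMap.mul ℝ ℂ) (f' := fun q => lineDeriv ℝ f q e)
    (g' := fun q => lineDeriv ℝ g q e) (v := e) ?_ ?_ ?_ ?_ ?_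
  · exact (hf.continuousOn_lineDeriv e hV).integrable_mul_of_tsupport hV hg.continuous hgc hgV
  · exact hf.continuousOn.integrable_mul_of_tsupport hV hg' hgc' (hs.trans hgV)
  · exact hf.continuousOn.integrable_mul_of_tsupport hV hg.continuous hgc hgV
  · intro q hq
    exact ((hf.contDiffAt (hV.mem_nhds (hgV hq))).differentiableAt
      one_ne_zero).lineDifferentiableAt.hasLineDerivAt
  · intro q _
    exact (hg.differentiable one_ne_zero q).lineDifferentiableAt.hasLineDerivAt

end Extension

/-! ### Operations on test functions -/

namespace IsTestFunction

variable {V V' : Set (ℝ × ℝ)} {φ χ : ℝ × ℝ → ℂ}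

theorem mono (h : IsTestFunction V φ) (hV : V ⊆ V') : IsTestFunction V' φ :=
  ⟨h.1, h.2.1, h.2.2.trans hV⟩

theorem mul_left (h : IsTestFunction V χ) (hφ : ContDiff ℝ ∞ φ) :
    IsTestFunction V fun q => φ q * χ q :=
  ⟨hφ.mul h.1, h.2.1.mul_left, (tsupport_mul_right_subset φ χ).trans h.2.2⟩

theorem lineDerivative (h : IsTestFunction V φ) (e : ℝ × ℝ) :
    IsTestFunction V fun q => lineDeriv ℝ φ q e :=
  ⟨h.1.lineDeriv_infty e,
    h.2.1.of_isClosed_subset (isClosed_tsupport _) (tsupport_lineDeriv_subset e),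
    (tsupport_lineDeriv_subset e).trans h.2.2⟩

theorem contDiff_one (h : IsTestFunction V φ) : ContDiff ℝ 1 φ := h.1.of_le (by simp)

theorem continuous (h : IsTestFunction V φ) : Continuous φ := h.1.continuous

theorem eq_zero (h : IsTestFunction V φ) {q : ℝ × ℝ} (hq : q ∉ V) : φ q = 0 :=
  image_eq_zero_of_notMem_tsupport fun hq' => hq (h.2.2 hq')

theorem integrable_mul {f : ℝ × ℝ → ℂ} (h : IsTestFunction V φ) (hV : IsOpen V)
    (hf : ContinuousOn f V) : Integrable fun q => f q * φ q :=
  hf.integrable_mul_of_tsupport hV h.continuous h.2.1 h.2.2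

theorem integral_mul_lineDeriv {f : ℝ × ℝ → ℂ} (h : IsTestFunction V φ) (hV : IsOpen V)
    (hf : ContDiffOn ℝ 1 f V) (e : ℝ × ℝ) :
    ∫ q, f q * lineDeriv ℝ φ q e = -∫ q, lineDeriv ℝ f q e * φ q :=
  integral_mul_lineDeriv_of_tsupport e hV hf h.contDiff_one h.2.1 h.2.2

end IsTestFunction

/-! ### Mollification of functions with a bounded distributional Laplacian -/

section Mollification

open scoped Convolution

theorem lineDeriv_comp_sub (f : ℝ × ℝ → ℂ) (x t e : ℝ × ℝ) :
    lineDeriv ℝ (fun s => f (x - s)) t e = -lineDeriv ℝ f (x - t) e := by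
  have h := deriv_comp_neg (fun s : ℝ => f (x - t + s • e)) 0
  rw [neg_zero] at h
  rw [lineDeriv, lineDeriv, ← h]
  congr 1
  funext s
  congr 1
  rw [neg_smul]
  abel

theorem lineDeriv_lineDeriv_comp_sub (f : ℝ × ℝ → ℂ) (x t e : ℝ × ℝ) :
    lineDeriv ℝ (fun q => lineDeriv ℝ (fun s => f (x - s)) q e) t e
      = lineDeriv ℝ (fun q => lineDeriv ℝ f q e) (x - t) e := by
  simp only [lineDeriv_comp_sub]
  have h := lineDeriv_comp_sub (fun q => lineDeriv ℝ f q e) x t e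
  rw [lineDeriv] at h ⊢
  rw [← neg_eq_iff_eq_neg.2 h]
  exact deriv.neg

variable {ψ g η : ℝ × ℝ → ℂ}

theorem lineDeriv_convolution (hψ : LocallyIntegrable ψ) (hη : IsTestFunction univ η)
    (e x : ℝ × ℝ) :
    lineDeriv ℝ (ψ ⋆[ContinuousLinearMap.mul ℝ ℂ] η) x e
      = (ψ ⋆[ContinuousLinearMap.mul ℝ ℂ] fun q => lineDeriv ℝ η q e) x := by
  have h := hη.2.1.hasFDerivAt_convolution_right (ContinuousLinearMap.mul ℝ ℂ) hψ
    hη.contDiff_one x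
  rw [h.differentiableAt.lineDeriv_eq_fderiv, h.fderiv, convolution_precompR_apply _ hψ
    (hη.2.1.fderiv ℝ) (hη.contDiff_one.continuous_fderiv one_ne_zero),
    hη.contDiff_one.lineDeriv_eq_fderiv e one_ne_zero]

theorem convolution_mul_congr {a : ℝ × ℝ → ℂ} {f : ℝ × ℝ → ℝ} (x : ℝ × ℝ) :
    (a ⋆[ContinuousLinearMap.mul ℝ ℂ] fun q => (f q : ℂ)) x
      = (f ⋆[ContinuousLinearMap.lsmul ℝ ℝ] a) x := by
  rw [convolution_eq_swap, convolution_def]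
  simp [mul_comm]

/-- All derivatives are placed on the mollifier, and `hΔ` is applied to the reflected translate η(x
- ·). Two reflections of sign cancel in a second derivative. -/
theorem laplacianZX_convolution (hψ : Continuous ψ) (hψc : HasCompactSupport ψ)
    (hη : IsTestFunction univ η)
    (hΔ : ∀ φ, IsTestFunction univ φ → ∫ q, ψ q * laplacianZX φ q = ∫ q, g q * φ q)
    (x : ℝ × ℝ) :
    laplacianZX (ψ ⋆[ContinuousLinearMap.mul ℝ ℂ] η) x
      = (g ⋆[ContinuousLinearMap.mul ℝ ℂ] η) x := by
  have hψl : LocallyIntegrable ψ := hψ.locallyIntegrable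
  have hφ : IsTestFunction univ fun s => η (x - s) :=
    ⟨hη.1.comp (contDiff_const.sub contDiff_id),
      hη.2.1.comp_homeomorph (Homeomorph.subLeft x), subset_univ _⟩
  have h := hΔ _ hφ
  have hint (e : ℝ × ℝ) : Integrable fun t =>
      ψ t * lineDeriv ℝ (fun q => lineDeriv ℝ η q e) (x - t) e := by
    refine Continuous.integrable_of_hasCompactSupport ?_ hψc.mul_right
    exact hψ.mul (((hη.lineDerivative e).lineDerivative e).continuous.comp (by fun_prop))
  have hc (e : ℝ × ℝ) : lineDeriv ℝ (fun q => lineDeriv ℝ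
        (ψ ⋆[ContinuousLinearMap.mul ℝ ℂ] η) q e) x e
      = ∫ t, ψ t * lineDeriv ℝ (fun q => lineDeriv ℝ η q e) (x - t) e := by
    simp only [lineDeriv_convolution hψl hη]
    have := lineDeriv_convolution hψl (hη.lineDerivative e) e x
    rw [convolution_def] at this
    simpa using this
  rw [laplacianZX_eq_lineDeriv, hc, hc, ← integral_add (hint _) (hint _), convolution_def]
  simp only [laplacianZX_eq_lineDeriv, lineDeriv_lineDeriv_comp_sub] at h
  simp only [ContinuousLinearMap.mul_apply', ← mul_add]
  exact h

/-- The distributional Helmholtz equation for `u` may be tested with a continuous compactly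
supported function whose distributional Laplacian is bounded. -/
theorem integral_helmholtz_of_distributional_laplacian {U K : Set (ℝ × ℝ)} {u : ℝ × ℝ → ℂ}
    {κ : ℝ × ℝ → ℝ} {y : ℝ × ℝ} {H C : ℝ} (hU : IsOpen U) (hK : IsCompact K) (hKU : K ⊆ U)
    (hκ : Measurable κ) (hκH : ∀ q ∈ U, |κ q| ≤ H)
    (hu : LocallyIntegrableOn u U)
    (hsol : ∀ φ, IsTestFunction U φ →
      ∫ q in U, u q * (-laplacianZX φ q - (κ q : ℂ) * φ q) = φ y)
    (hψ : Continuous ψ) (hψK : ∀ q ∉ K, ψ q = 0)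
    (hg : AEStronglyMeasurable g) (hgC : ∀ q, ‖g q‖ ≤ C) (hgK : ∀ q ∉ K, g q = 0)
    (hΔ : ∀ φ, IsTestFunction univ φ → ∫ q, ψ q * laplacianZX φ q = ∫ q, g q * φ q) :
    ∫ q in U, u q * (-g q - (κ q : ℂ) * ψ q) = ψ y := by
  have hψc : HasCompactSupport ψ := HasCompactSupport.intro hK hψK
  obtain ⟨δ, hδ, hδU⟩ := hK.exists_cthickening_subset_open hU hKU
  set K' := Metric.cthickening δ K
  have hK' : IsCompact K' := hK.cthickening
  -- Radii at most δ keep the mollified functions supported in `K'`. The fixed ratio 2 of the radii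
  -- is what the almost everywhere convergence of the mollified g requires.
  let B (n : ℕ) : ContDiffBump (0 : ℝ × ℝ) :=
    ⟨δ / (n + 2) / 2, δ / (n + 2), by positivity, half_lt_self (by positivity)⟩
  have hBlim : Tendsto (fun n => (B n).rOut) atTop (𝓝 0) := by
    have := (tendsto_const_div_atTop_nhds_zero_nat δ).comp (tendsto_add_atTop_nat 2)
    refine this.congr fun n => ?_
    simp [B]
  have hBδ (n : ℕ) : (B n).rOut ≤ δ :=
    div_le_self hδ.le (by linarith [(n.cast_nonneg : (0 : ℝ) ≤ n)])
  let b (n : ℕ) : ℝ × ℝ → ℂ := fun q => ((B n).normed volume q : ℂ)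
  have hb (n : ℕ) : IsTestFunction univ (b n) :=
    ⟨Complex.ofRealCLM.contDiff.comp (B n).contDiff_normed,
      (B n).hasCompactSupport_normed.comp_left (g := Complex.ofReal) (by simp), subset_univ _⟩
  have hvan {a : ℝ × ℝ → ℂ} (ha : ∀ q ∉ K, a q = 0) (n : ℕ) (x : ℝ × ℝ) (hx : x ∉ K') :
      (a ⋆[ContinuousLinearMap.mul ℝ ℂ] b n) x = 0 := by
    rw [convolution_def]
    refine integral_eq_zero_of_ae (Eventually.of_forall fun t => ?_)
    by_contra h
    simp only [Pi.zero_apply, ContinuousLinearMap.mul_apply', mul_eq_zero, not_or] at h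
    have ht : t ∈ K := by
      by_contra ht
      exact h.1 (ha t ht)
    have h2 : x - t ∈ Function.support ((B n).normed volume) := fun h0 => h.2 (by simp [b, h0])
    rw [(B n).support_normed_eq, mem_ball_zero_iff] at h2
    refine hx (Metric.mem_cthickening_of_dist_le x t δ K ht ?_)
    rw [dist_eq_norm]
    exact h2.le.trans (hBδ n)
  set ψn : ℕ → ℝ × ℝ → ℂ := fun n => ψ ⋆[ContinuousLinearMap.mul ℝ ℂ] b n
  set gn : ℕ → ℝ × ℝ → ℂ := fun n => g ⋆[ContinuousLinearMap.mul ℝ ℂ] b n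
  -- A crude constant: the average is within 2A of the value of a at x, which is itself at most A.
  have hbound {a : ℝ × ℝ → ℂ} {A : ℝ} (ham : AEStronglyMeasurable a) (ha : ∀ q, ‖a q‖ ≤ A)
      (n : ℕ) (x : ℝ × ℝ) : ‖(a ⋆[ContinuousLinearMap.mul ℝ ℂ] b n) x‖ ≤ 3 * A := by
    have h1 := (B n).dist_normed_convolution_le (x₀ := x) (ε := 2 * A) ham fun q _ => by
      rw [dist_eq_norm]
      linarith [norm_sub_le (a q) (a x), ha q, ha x]
    have h2 : (a ⋆[ContinuousLinearMap.mul ℝ ℂ] b n) x = _ := convolution_mul_congr x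
    rw [← h2, dist_eq_norm] at h1
    have h3 := norm_sub_norm_le ((a ⋆[ContinuousLinearMap.mul ℝ ℂ] b n) x) (a x)
    linarith [ha x]
  have hψnt (n : ℕ) : IsTestFunction U (ψn n) := by
    have hsub : tsupport (ψn n) ⊆ K' := by
      refine closure_minimal (fun x hx => ?_) hK'.isClosed
      by_contra h
      exact hx (hvan hψK n x h)
    refine ⟨(hb n).2.1.contDiff_convolution_right _ hψ.locallyIntegrable (n := ⊤) (hb n).1,
      hK'.of_isClosed_subset (isClosed_tsupport _) hsub, hsub.trans hδU⟩
  have hlap (n : ℕ) (x : ℝ × ℝ) : laplacianZX (ψn n) x = gn n x :=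
    laplacianZX_convolution hψ hψc (hb n) hΔ x
  obtain ⟨A, hA⟩ := hψc.exists_bound_of_continuous hψ
  have huK : IntegrableOn u K' := hu.integrableOn_compact_subset hδU hK'
  have hKK : K ⊆ K' := Metric.self_subset_cthickening K
  have hred {F : ℝ × ℝ → ℂ} (hF : ∀ q ∉ K', F q = 0) : ∫ q in U, F q = ∫ q in K', F q :=
    setIntegral_eq_of_subset_of_forall_sdiff_eq_zero hU.measurableSet hδU fun q hq => hF q hq.2
  have hgl : LocallyIntegrable g := by
    refine Integrable.locallyIntegrable ?_
    have : IntegrableOn g K :=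
      Measure.integrableOn_of_bounded hK.measure_lt_top.ne hg
        (Eventually.of_forall fun q => hgC q)
    exact this.integrable_of_forall_notMem_eq_zero hgK
  -- Dominated convergence against a multiple of |u|. Mollified ψ converges everywhere by
  -- continuity, mollified g only almost everywhere, by Lebesgue differentiation.
  have hlim : Tendsto (fun n => ∫ q in K', u q * (-laplacianZX (ψn n) q - (κ q : ℂ) * ψn n q))
      atTop (𝓝 (∫ q in K', u q * (-g q - (κ q : ℂ) * ψ q))) := by
    refine tendsto_integral_of_dominated_convergence (fun q => ‖u q‖ * (3 * C + H * (3 * A)))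
      ?_ (huK.norm.mul_const _) ?_ ?_
    · intro n
      refine huK.1.mul (AEStronglyMeasurable.sub ?_ ?_)
      · simp only [laplacianZX_eq_lineDeriv]
        exact ((((hψnt n).lineDerivative _).lineDerivative _).continuous.add
          (((hψnt n).lineDerivative _).lineDerivative _).continuous).neg.aestronglyMeasurable
      · exact (Complex.measurable_ofReal.comp hκ).aestronglyMeasurable.mul
          (hψnt n).continuous.aestronglyMeasurable
    · intro n
      filter_upwards [ae_restrict_mem hK'.isClosed.measurableSet] with q hq
      rw [norm_mul, hlap]
      refine mul_le_mul_of_nonneg_left ((norm_sub_le _ _).trans ?_) (norm_nonneg _)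
      rw [norm_neg, norm_mul, Complex.norm_real, Real.norm_eq_abs]
      exact add_le_add (hbound hg hgC n q) (mul_le_mul (hκH q (hδU hq))
        (hbound hψ.aestronglyMeasurable hA n q) (norm_nonneg _)
        ((abs_nonneg _).trans (hκH q (hδU hq))))
    · have h1 := ContDiffBump.ae_convolution_tendsto_right_of_locallyIntegrable (φ := B)
        (l := atTop) (K := 2) hBlim (Eventually.of_forall fun n => by simp [B]; linarith) hgl
      filter_upwards [ae_restrict_of_ae h1] with q hq
      have h2 := ContDiffBump.convolution_tendsto_right_of_continuous (μ := volume) hBlim hψ q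
      simp only [← convolution_mul_congr] at hq h2
      simp only [hlap]
      exact (hq.neg.sub (h2.const_mul _)).const_mul _
  have hψlim : Tendsto (fun n => ψn n y) atTop (𝓝 (ψ y)) := by
    have h2 := ContDiffBump.convolution_tendsto_right_of_continuous (μ := volume) hBlim hψ y
    simpa only [← convolution_mul_congr] using h2
  rw [hred fun q hq => by simp [hgK q fun h => hq (hKK h), hψK q fun h => hq (hKK h)]]
  refine tendsto_nhds_unique hlim (hψlim.congr fun n => ?_)
  rw [← hsol _ (hψnt n), hred fun q hq => ?_]
  rw [hlap, show gn n q = 0 from hvan hgK n q hq, show ψn n q = 0 from hvan hψK n q hq]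
  simp

end Mollification

/-! ### Point source solutions in an open set -/

/-- The bilinear product `∇u · ∇v`. -/
noncomputable def gradDot (u v : ℝ × ℝ → ℂ) (p : ℝ × ℝ) : ℂ :=
  lineDeriv ℝ u p (1, 0) * lineDeriv ℝ v p (1, 0) + lineDeriv ℝ u p (0, 1) * lineDeriv ℝ v p (0, 1)

theorem gradDot_comm (u v : ℝ × ℝ → ℂ) (p : ℝ × ℝ) : gradDot u v p = gradDot v u p := by
  simp only [gradDot, mul_comm]

theorem gradDot_mul_right {u f g : ℝ × ℝ → ℂ} {p : ℝ × ℝ} (hf : DifferentiableAt ℝ f p)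
    (hg : DifferentiableAt ℝ g p) :
    gradDot u (fun q => f q * g q) p = f p * gradDot u g p + g p * gradDot u f p := by
  simp only [gradDot, lineDeriv_mul _ hf hg]
  ring

/-- `u` is `C¹` in `U` off the source `y`, locally integrable, and `-Δu - κ u = δ(· - y)` in the
sense of distributions. -/
structure IsPointSourceSolution (U : Set (ℝ × ℝ)) (κ : ℝ × ℝ → ℝ) (y : ℝ × ℝ)
    (u : ℝ × ℝ → ℂ) : Prop where
  contDiffOn : ContDiffOn ℝ 1 u (U \ {y})
  locallyIntegrableOn : LocallyIntegrableOn u U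
  helmholtz : ∀ φ, IsTestFunction U φ →
    ∫ q in U, u q * (-laplacianZX φ q - (κ q : ℂ) * φ q) = φ y

/-- `κ` is measurable, and bounded on `U`. -/
structure IsBoundedCoefficient (U : Set (ℝ × ℝ)) (κ : ℝ × ℝ → ℝ) : Prop where
  measurable : Measurable κ
  bounded : ∃ H, ∀ q ∈ U, |κ q| ≤ H

theorem IsTestFunction.integrable_gradDot {V : Set (ℝ × ℝ)} {u φ : ℝ × ℝ → ℂ} (hV : IsOpen V)
    (hu : ContDiffOn ℝ 1 u V) (hφ : IsTestFunction V φ) : Integrable (gradDot u φ) :=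
  ((hφ.lineDerivative _).integrable_mul hV (hu.continuousOn_lineDeriv _ hV)).add
    ((hφ.lineDerivative _).integrable_mul hV (hu.continuousOn_lineDeriv _ hV))

theorem IsBoundedCoefficient.integrableOn_mul {U S : Set (ℝ × ℝ)} {κ : ℝ × ℝ → ℝ} {F : ℝ × ℝ → ℂ}
    (hκ : IsBoundedCoefficient U κ) (hU : IsOpen U) (hSU : S ⊆ U) (hF : IntegrableOn F S) :
    IntegrableOn (fun q => (κ q : ℂ) * F q) S := by
  obtain ⟨H, hH⟩ := hκ.bounded
  refine Integrable.bdd_mul (c := H) hF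
    (Complex.measurable_ofReal.comp hκ.measurable).aestronglyMeasurable ?_
  refine ae_mono (Measure.restrict_mono_set _ hSU) ?_
  filter_upwards [ae_restrict_mem hU.measurableSet] with q hq
  simpa using hH q hq

theorem IsTestFunction.integral_mul_laplacianZX {V : Set (ℝ × ℝ)} {u φ : ℝ × ℝ → ℂ}
    (hV : IsOpen V) (hu : ContDiffOn ℝ 1 u V) (hφ : IsTestFunction V φ) :
    ∫ q, u q * laplacianZX φ q = -∫ q, gradDot u φ q := by
  have h1 (e : ℝ × ℝ) := ((hφ.lineDerivative e).lineDerivative e).integrable_mul hV hu.continuousOn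
  have h2 (e : ℝ × ℝ) := (hφ.lineDerivative e).integrable_mul hV (hu.continuousOn_lineDeriv e hV)
  simp only [laplacianZX_eq_lineDeriv, gradDot, mul_add]
  rw [integral_add (h1 _) (h1 _), integral_add (h2 _) (h2 _),
    (hφ.lineDerivative _).integral_mul_lineDeriv hV hu, (hφ.lineDerivative _).integral_mul_lineDeriv hV hu]
  ring

theorem IsTestFunction.integrable_mul_laplacianZX {V : Set (ℝ × ℝ)} {u φ : ℝ × ℝ → ℂ}
    (hV : IsOpen V) (hu : ContinuousOn u V) (hφ : IsTestFunction V φ) :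
    Integrable fun q => u q * laplacianZX φ q := by
  have h1 (e : ℝ × ℝ) := ((hφ.lineDerivative e).lineDerivative e).integrable_mul hV hu
  simp only [laplacianZX_eq_lineDeriv, mul_add]
  exact (h1 _).add (h1 _)

theorem IsTestFunction.laplacianZX_eq_zero {V : Set (ℝ × ℝ)} {φ : ℝ × ℝ → ℂ}
    (hφ : IsTestFunction V φ) {q : ℝ × ℝ} (hq : q ∉ V) : laplacianZX φ q = 0 := by
  rw [laplacianZX_eq_lineDeriv, ((hφ.lineDerivative _).lineDerivative _).eq_zero hq,
    ((hφ.lineDerivative _).lineDerivative _).eq_zero hq, add_zero]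

theorem IsTestFunction.gradDot_eq_zero {V : Set (ℝ × ℝ)} {u φ : ℝ × ℝ → ℂ}
    (hφ : IsTestFunction V φ) {q : ℝ × ℝ} (hq : q ∉ V) : gradDot u φ q = 0 := by
  simp [gradDot, (hφ.lineDerivative _).eq_zero hq]

/-- The variational form of the Helmholtz equation, tested away from the source. -/
theorem IsPointSourceSolution.integral_gradDot {U : Set (ℝ × ℝ)} {κ : ℝ × ℝ → ℝ} {y : ℝ × ℝ}
    {v φ : ℝ × ℝ → ℂ} (hU : IsOpen U) (hκ : IsBoundedCoefficient U κ)
    (hv : IsPointSourceSolution U κ y v) (hφ : IsTestFunction (U \ {y}) φ) :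
    ∫ q, gradDot v φ q = ∫ q in U, (κ q : ℂ) * (v q * φ q) := by
  have hV : IsOpen (U \ {y}) := hU.sdiff isClosed_singleton
  have h := hv.helmholtz φ (hφ.mono sdiff_subset)
  rw [hφ.eq_zero (by simp)] at h
  have h1 := hφ.integral_mul_laplacianZX hV hv.contDiffOn
  have h2 := hφ.integrable_mul_laplacianZX hV hv.contDiffOn.continuousOn
  have h3 := hκ.integrableOn_mul hU subset_rfl
    (hφ.integrable_mul hV hv.contDiffOn.continuousOn).integrableOn
  have h4 : ∫ q in U, v q * laplacianZX φ q = ∫ q, v q * laplacianZX φ q :=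
    setIntegral_eq_integral_of_forall_compl_eq_zero fun q hq => by
      rw [(hφ.mono sdiff_subset).laplacianZX_eq_zero hq, mul_zero]
  have h5 : ∫ q in U, v q * (-laplacianZX φ q - (κ q : ℂ) * φ q)
      = ∫ q in U, (-(v q * laplacianZX φ q) - (κ q : ℂ) * (v q * φ q)) := by
    congr 1
    funext q
    ring
  rw [h5, integral_sub (f := fun q => -(v q * laplacianZX φ q)) h2.integrableOn.neg h3,
    integral_neg, h4, h1] at h
  linear_combination h

/-- The Leibniz rule for the second derivative of vχ in weak form. As v is only C¹, the term χ∂²v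
survives as the last integral, in the shape to which the variational equation of v applies. -/
theorem IsTestFunction.integral_mul_mul_lineDeriv_lineDeriv {V : Set (ℝ × ℝ)}
    {v χ φ : ℝ × ℝ → ℂ} (hV : IsOpen V) (hv : ContDiffOn ℝ 1 v V) (hχ : IsTestFunction V χ)
    (hφ : IsTestFunction univ φ) (e : ℝ × ℝ) :
    ∫ q, v q * χ q * lineDeriv ℝ (fun q => lineDeriv ℝ φ q e) q e
      = (∫ q, (v q * lineDeriv ℝ (fun q => lineDeriv ℝ χ q e) q e
          + 2 * (lineDeriv ℝ v q e * lineDeriv ℝ χ q e)) * φ q)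
        - ∫ q, lineDeriv ℝ v q e * lineDeriv ℝ (fun q => φ q * χ q) q e := by
  have hχe := hχ.lineDerivative e
  have hχee := hχe.lineDerivative e
  have hφe := hφ.lineDerivative e
  have hve := hv.continuousOn_lineDeriv e hV
  have h1 : ContDiff ℝ 1 fun q => v q * χ q :=
    hv.contDiff_mul_of_tsupport hV hχ.contDiff_one hχ.2.2
  have h2 : ContDiff ℝ 1 fun q => v q * lineDeriv ℝ χ q e :=
    hv.contDiff_mul_of_tsupport hV hχe.contDiff_one hχe.2.2
  -- Outside V, where v need not be differentiable, both sides vanish because a is zero nearby.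
  have hd {a : ℝ × ℝ → ℂ} (ha : IsTestFunction V a) (q : ℝ × ℝ) :
      lineDeriv ℝ (fun q => v q * a q) q e = v q * lineDeriv ℝ a q e + lineDeriv ℝ v q e * a q := by
    by_cases hq : q ∈ V
    · exact lineDeriv_mul e ((hv.contDiffAt (hV.mem_nhds hq)).differentiableAt one_ne_zero)
        (ha.contDiff_one.differentiable one_ne_zero q)
    · rw [(ha.lineDerivative e).eq_zero hq, ha.eq_zero hq]
      simp only [mul_zero, add_zero]
      refine lineDeriv_of_eventuallyEq_const e (a := 0) (notMem_tsupport_iff_eventuallyEq.1 ?_)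
      exact fun h => hq (ha.2.2 (tsupport_mul_right_subset v a h))
  have hdφ (q : ℝ × ℝ) : lineDeriv ℝ (fun q => φ q * χ q) q e
      = φ q * lineDeriv ℝ χ q e + lineDeriv ℝ φ q e * χ q :=
    lineDeriv_mul e (hφ.contDiff_one.differentiable one_ne_zero q)
      (hχ.contDiff_one.differentiable one_ne_zero q)
  have e1 := hφe.integral_mul_lineDeriv isOpen_univ h1.contDiffOn e
  have e2 := hφ.integral_mul_lineDeriv isOpen_univ h2.contDiffOn e
  simp only [hd hχ, hd hχe] at e1 e2
  simp only [hdφ]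
  have i1 : Integrable fun q => v q * lineDeriv ℝ χ q e * lineDeriv ℝ φ q e :=
    hφe.integrable_mul isOpen_univ h2.continuous.continuousOn
  have i2 : Integrable fun q => lineDeriv ℝ v q e * χ q * lineDeriv ℝ φ q e :=
    hφe.integrable_mul isOpen_univ
      (hve.continuous_mul_of_tsupport hV hχ.continuous hχ.2.2).continuousOn
  have i3 : Integrable fun q => v q * lineDeriv ℝ (fun q => lineDeriv ℝ χ q e) q e * φ q :=
    hφ.integrable_mul isOpen_univ (hv.continuousOn.continuous_mul_of_tsupport hV
      hχee.continuous hχee.2.2).continuousOn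
  have i4 : Integrable fun q => lineDeriv ℝ v q e * lineDeriv ℝ χ q e * φ q :=
    hφ.integrable_mul isOpen_univ (hve.continuous_mul_of_tsupport hV
      hχe.continuous hχe.2.2).continuousOn
  have r1 : ∫ q, (v q * lineDeriv ℝ χ q e + lineDeriv ℝ v q e * χ q) * lineDeriv ℝ φ q e
      = (∫ q, v q * lineDeriv ℝ χ q e * lineDeriv ℝ φ q e)
        + ∫ q, lineDeriv ℝ v q e * χ q * lineDeriv ℝ φ q e := by
    rw [← integral_add i1 i2]
    simp only [add_mul]
  have r2 : ∫ q, (v q * lineDeriv ℝ (fun q => lineDeriv ℝ χ q e) q e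
        + lineDeriv ℝ v q e * lineDeriv ℝ χ q e) * φ q
      = (∫ q, v q * lineDeriv ℝ (fun q => lineDeriv ℝ χ q e) q e * φ q)
        + ∫ q, lineDeriv ℝ v q e * lineDeriv ℝ χ q e * φ q := by
    rw [← integral_add i3 i4]
    simp only [add_mul]
  have r3 : ∫ q, (v q * lineDeriv ℝ (fun q => lineDeriv ℝ χ q e) q e
        + 2 * (lineDeriv ℝ v q e * lineDeriv ℝ χ q e)) * φ q
      = (∫ q, v q * lineDeriv ℝ (fun q => lineDeriv ℝ χ q e) q e * φ q)
        + 2 * ∫ q, lineDeriv ℝ v q e * lineDeriv ℝ χ q e * φ q := by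
    rw [← integral_const_mul, ← integral_add i3 (i4.const_mul 2)]
    congr 1
    funext q
    ring
  have r4 : ∫ q, lineDeriv ℝ v q e * (φ q * lineDeriv ℝ χ q e + lineDeriv ℝ φ q e * χ q)
      = (∫ q, lineDeriv ℝ v q e * lineDeriv ℝ χ q e * φ q)
        + ∫ q, lineDeriv ℝ v q e * χ q * lineDeriv ℝ φ q e := by
    rw [← integral_add i4 i2]
    congr 1
    funext q
    ring
  rw [e1, r1, r3, r4]
  rw [r2] at e2
  linear_combination -e2

/-- The distributional Laplacian of the solution times a cutoff that avoids the source. -/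
theorem IsPointSourceSolution.integral_mul_cutoff_laplacianZX {U : Set (ℝ × ℝ)}
    {κ : ℝ × ℝ → ℝ} {y : ℝ × ℝ} {v χ φ : ℝ × ℝ → ℂ} (hU : IsOpen U)
    (hκ : IsBoundedCoefficient U κ) (hv : IsPointSourceSolution U κ y v)
    (hχ : IsTestFunction (U \ {y}) χ) (hφ : IsTestFunction univ φ) :
    ∫ q, v q * χ q * laplacianZX φ q
      = ∫ q, (v q * laplacianZX χ q + 2 * gradDot v χ q - (κ q : ℂ) * (v q * χ q)) * φ q := by
  have hV : IsOpen (U \ {y}) := hU.sdiff isClosed_singleton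
  have hc := hv.contDiffOn
  have hχφ : IsTestFunction (U \ {y}) fun q => φ q * χ q := hχ.mul_left hφ.1
  -- This replaces the weak form of χΔv by -κvχ.
  have hw := hv.integral_gradDot hU hκ hχφ
  have hd (e : ℝ × ℝ) := hχ.integral_mul_mul_lineDeriv_lineDeriv hV hc hφ e
  have j0 (e : ℝ × ℝ) :
      Integrable fun q => v q * χ q * lineDeriv ℝ (fun q => lineDeriv ℝ φ q e) q e :=
    ((hφ.lineDerivative e).lineDerivative e).integrable_mul isOpen_univ
      (hc.continuousOn.continuous_mul_of_tsupport hV hχ.continuous hχ.2.2).continuousOn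
  have j1 (e : ℝ × ℝ) :
      Integrable fun q => (v q * lineDeriv ℝ (fun q => lineDeriv ℝ χ q e) q e
        + 2 * (lineDeriv ℝ v q e * lineDeriv ℝ χ q e)) * φ q := by
    refine hφ.integrable_mul isOpen_univ (Continuous.continuousOn ?_)
    exact (hc.continuousOn.continuous_mul_of_tsupport hV
      ((hχ.lineDerivative e).lineDerivative e).continuous ((hχ.lineDerivative e).lineDerivative e).2.2).add
      (continuous_const.mul ((hc.continuousOn_lineDeriv e hV).continuous_mul_of_tsupport hV
        (hχ.lineDerivative e).continuous (hχ.lineDerivative e).2.2))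
  have j2 (e : ℝ × ℝ) :
      Integrable fun q => lineDeriv ℝ v q e * lineDeriv ℝ (fun q => φ q * χ q) q e :=
    (hχφ.lineDerivative e).integrable_mul hV (hc.continuousOn_lineDeriv e hV)
  have hκi : IntegrableOn (fun q => (κ q : ℂ) * (v q * (φ q * χ q))) U :=
    hκ.integrableOn_mul hU subset_rfl (hχφ.integrable_mul hV hc.continuousOn).integrableOn
  have hκz : ∀ q ∉ U, (κ q : ℂ) * (v q * (φ q * χ q)) = 0 := fun q hq => by
    simp [(hχ.mono sdiff_subset).eq_zero hq]
  have hκI : Integrable fun q => (κ q : ℂ) * (v q * (φ q * χ q)) :=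
    hκi.integrable_of_forall_notMem_eq_zero hκz
  rw [setIntegral_eq_integral_of_forall_compl_eq_zero hκz] at hw
  have s1 : ∫ q, v q * χ q * laplacianZX φ q
      = (∫ q, v q * χ q * lineDeriv ℝ (fun q => lineDeriv ℝ φ q (1, 0)) q (1, 0))
        + ∫ q, v q * χ q * lineDeriv ℝ (fun q => lineDeriv ℝ φ q (0, 1)) q (0, 1) := by
    rw [← integral_add (j0 _) (j0 _)]
    simp only [laplacianZX_eq_lineDeriv, mul_add]
  have s2 : ∫ q, (v q * laplacianZX χ q + 2 * gradDot v χ q - (κ q : ℂ) * (v q * χ q)) * φ q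
      = (∫ q, (v q * lineDeriv ℝ (fun q => lineDeriv ℝ χ q (1, 0)) q (1, 0)
          + 2 * (lineDeriv ℝ v q (1, 0) * lineDeriv ℝ χ q (1, 0))) * φ q)
        + (∫ q, (v q * lineDeriv ℝ (fun q => lineDeriv ℝ χ q (0, 1)) q (0, 1)
          + 2 * (lineDeriv ℝ v q (0, 1) * lineDeriv ℝ χ q (0, 1))) * φ q)
        - ∫ q, (κ q : ℂ) * (v q * (φ q * χ q)) := by
    rw [← integral_add (j1 _) (j1 _)]
    refine Eq.trans ?_ (integral_sub ((j1 (1, 0)).add (j1 (0, 1))) hκI)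
    congr 1
    funext q
    simp only [laplacianZX_eq_lineDeriv, gradDot]
    ring
  have s3 : ∫ q, gradDot v (fun q => φ q * χ q) q
      = (∫ q, lineDeriv ℝ v q (1, 0) * lineDeriv ℝ (fun q => φ q * χ q) q (1, 0))
        + ∫ q, lineDeriv ℝ v q (0, 1) * lineDeriv ℝ (fun q => φ q * χ q) q (0, 1) :=
    integral_add (j2 _) (j2 _)
  rw [s1, s2, hd, hd, ← hw, s3]
  ring

/-- The value of one point source solution at the source of another, as an integral over the
transition region of a cutoff. -/
theorem IsPointSourceSolution.eq_integral_gradDot {U : Set (ℝ × ℝ)} {κ : ℝ × ℝ → ℝ}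
    {x₁ x₂ : ℝ × ℝ} {u v χ : ℝ × ℝ → ℂ} (hU : IsOpen U) (hκ : IsBoundedCoefficient U κ)
    (hu : IsPointSourceSolution U κ x₁ u) (hv : IsPointSourceSolution U κ x₂ v)
    (hχ : IsTestFunction (U \ {x₂}) χ) (hχ1 : χ =ᶠ[𝓝 x₁] fun _ => 1) :
    Integrable (fun q => v q * gradDot u χ q - u q * gradDot v χ q) ∧
    v x₁ = ∫ q, (v q * gradDot u χ q - u q * gradDot v χ q) := by
  have hV : IsOpen (U \ {x₂}) := hU.sdiff isClosed_singleton
  have hvc := hv.contDiffOn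
  obtain ⟨H, hH⟩ := hκ.bounded
  -- The distributional Laplacian of vχ. It is bounded: the first two terms are continuous with
  -- compact support, and κ is bounded on U.
  set g : ℝ × ℝ → ℂ := fun q =>
    v q * laplacianZX χ q + 2 * gradDot v χ q - (κ q : ℂ) * (v q * χ q)
  have hψ : Continuous fun q => v q * χ q :=
    hvc.continuousOn.continuous_mul_of_tsupport hV hχ.continuous hχ.2.2
  have hK : tsupport χ ⊆ U := hχ.2.2.trans sdiff_subset
  have hχK : IsTestFunction (tsupport χ) χ := ⟨hχ.1, hχ.2.1, subset_rfl⟩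
  have hg1 : Continuous fun q => v q * laplacianZX χ q + 2 * gradDot v χ q := by
    simp only [laplacianZX_eq_lineDeriv, gradDot, mul_add]
    have a (e : ℝ × ℝ) := hvc.continuousOn.continuous_mul_of_tsupport hV
      ((hχ.lineDerivative e).lineDerivative e).continuous ((hχ.lineDerivative e).lineDerivative e).2.2
    have b (e : ℝ × ℝ) := (hvc.continuousOn_lineDeriv e hV).continuous_mul_of_tsupport hV
      (hχ.lineDerivative e).continuous (hχ.lineDerivative e).2.2
    exact ((a _).add (a _)).add ((continuous_const.mul (b _)).add (continuous_const.mul (b _)))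
  have hz1 : ∀ q ∉ tsupport χ, v q * laplacianZX χ q + 2 * gradDot v χ q = 0 := fun q hq => by
    rw [hχK.laplacianZX_eq_zero hq, hχK.gradDot_eq_zero hq]
    simp
  have hz2 : ∀ q ∉ tsupport χ, v q * χ q = 0 := fun q hq => by
    rw [hχK.eq_zero hq, mul_zero]
  obtain ⟨C₁, hC₁⟩ := (HasCompactSupport.intro hχ.2.1 hz1).exists_bound_of_continuous hg1
  obtain ⟨C₂, hC₂⟩ := (HasCompactSupport.intro hχ.2.1 hz2).exists_bound_of_continuous hψ
  have hx₁ : x₁ ∈ U := by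
    refine hK (subset_tsupport χ ?_)
    rw [Function.mem_support, hχ1.self_of_nhds]
    exact one_ne_zero
  have hH0 : 0 ≤ H := (abs_nonneg _).trans (hH x₁ hx₁)
  have hmain := integral_helmholtz_of_distributional_laplacian (g := g)
    (ψ := fun q => v q * χ q) (C := C₁ + H * C₂) hU hχ.2.1 hK hκ.measurable hH
    hu.locallyIntegrableOn hu.helmholtz hψ hz2
    (hg1.aestronglyMeasurable.sub
      ((Complex.measurable_ofReal.comp hκ.measurable).aestronglyMeasurable.mul
        hψ.aestronglyMeasurable))
    (fun q => by
      by_cases hq : q ∈ U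
      · refine (norm_sub_le _ _).trans (add_le_add (hC₁ q) ?_)
        rw [norm_mul, Complex.norm_real, Real.norm_eq_abs]
        exact mul_le_mul (hH q hq) (hC₂ q) (norm_nonneg _) hH0
      · have : g q = 0 := by
          simp only [g, hz1 q fun h => hq (hK h), hz2 q fun h => hq (hK h)]
          simp
        rw [this, norm_zero]
        exact add_nonneg ((norm_nonneg _).trans (hC₁ q))
          (mul_nonneg hH0 ((norm_nonneg _).trans (hC₂ q))))
    (fun q hq => by simp only [g, hz1 q hq, hz2 q hq]; simp)
    (fun φ hφ => hv.integral_mul_cutoff_laplacianZX hU hκ hχ hφ)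
  simp only [hχ1.self_of_nhds, mul_one] at hmain
  rw [← hmain]
  set V := (U \ {x₂}) \ {x₁}
  have hVo : IsOpen V := hV.sdiff isClosed_singleton
  have huV : ContDiffOn ℝ 1 u V := hu.contDiffOn.mono fun q hq => ⟨hq.1.1, hq.2⟩
  have hvV : ContDiffOn ℝ 1 v V := hvc.mono sdiff_subset
  -- The cutoff is constant near x₁ and vanishes near x₂, so its derivatives are supported where
  -- both u and v are C¹. This permits integrating the product uv by parts.
  have hχe (e : ℝ × ℝ) : IsTestFunction V fun q => lineDeriv ℝ χ q e := by
    refine ⟨(hχ.lineDerivative e).1, (hχ.lineDerivative e).2.1, fun q hq => ⟨(hχ.lineDerivative e).2.2 hq, ?_⟩⟩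
    rintro rfl
    refine notMem_tsupport_iff_eventuallyEq.2 ?_ hq
    filter_upwards [hχ1.eventuallyEq_nhds] with p hp
    exact lineDeriv_of_eventuallyEq_const e hp
  have key (e : ℝ × ℝ) : ∫ q, u q * v q * lineDeriv ℝ (fun q => lineDeriv ℝ χ q e) q e
      = -∫ q, (u q * lineDeriv ℝ v q e + lineDeriv ℝ u q e * v q) * lineDeriv ℝ χ q e := by
    rw [(hχe e).integral_mul_lineDeriv hVo (huV.mul hvV)]
    congr 2
    funext q
    by_cases hq : q ∈ V
    · rw [lineDeriv_mul e ((huV.contDiffAt (hVo.mem_nhds hq)).differentiableAt one_ne_zero)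
        ((hvV.contDiffAt (hVo.mem_nhds hq)).differentiableAt one_ne_zero)]
    · rw [(hχe e).eq_zero hq, mul_zero, mul_zero]
  have k1 (e : ℝ × ℝ) :
      Integrable fun q => u q * v q * lineDeriv ℝ (fun q => lineDeriv ℝ χ q e) q e :=
    ((hχe e).lineDerivative e).integrable_mul hVo (huV.continuousOn.mul hvV.continuousOn)
  have k2 (e : ℝ × ℝ) : Integrable fun q => u q * lineDeriv ℝ v q e * lineDeriv ℝ χ q e :=
    (hχe e).integrable_mul hVo (huV.continuousOn.mul (hvV.continuousOn_lineDeriv e hVo))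
  have k3 (e : ℝ × ℝ) : Integrable fun q => lineDeriv ℝ u q e * v q * lineDeriv ℝ χ q e :=
    (hχe e).integrable_mul hVo ((huV.continuousOn_lineDeriv e hVo).mul hvV.continuousOn)
  have key' (e : ℝ × ℝ) :
      ∫ q, -(u q * v q * lineDeriv ℝ (fun q => lineDeriv ℝ χ q e) q e
        + 2 * (u q * lineDeriv ℝ v q e * lineDeriv ℝ χ q e))
      = ∫ q, (lineDeriv ℝ u q e * v q * lineDeriv ℝ χ q e
        - u q * lineDeriv ℝ v q e * lineDeriv ℝ χ q e) := by
    have hk := key e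
    have : ∫ q, (u q * lineDeriv ℝ v q e + lineDeriv ℝ u q e * v q) * lineDeriv ℝ χ q e
        = (∫ q, u q * lineDeriv ℝ v q e * lineDeriv ℝ χ q e)
          + ∫ q, lineDeriv ℝ u q e * v q * lineDeriv ℝ χ q e := by
      rw [← integral_add (k2 e) (k3 e)]
      simp only [add_mul]
    rw [integral_neg, integral_add (k1 e) ((k2 e).const_mul 2), integral_const_mul,
      integral_sub (k3 e) (k2 e), hk, this]
    ring
  have hz3 : ∀ q ∉ U, u q * (-g q - (κ q : ℂ) * (v q * χ q)) = 0 := fun q hq => by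
    simp only [g, hz1 q fun h => hq (hK h), hz2 q fun h => hq (hK h)]
    simp
  rw [setIntegral_eq_integral_of_forall_compl_eq_zero hz3]
  -- The κ terms cancel here, leaving only terms with a derivative of χ.
  have t1 : (fun q => u q * (-g q - (κ q : ℂ) * (v q * χ q))) = fun q =>
      -(u q * v q * lineDeriv ℝ (fun q => lineDeriv ℝ χ q (1, 0)) q (1, 0)
        + 2 * (u q * lineDeriv ℝ v q (1, 0) * lineDeriv ℝ χ q (1, 0)))
      + -(u q * v q * lineDeriv ℝ (fun q => lineDeriv ℝ χ q (0, 1)) q (0, 1)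
        + 2 * (u q * lineDeriv ℝ v q (0, 1) * lineDeriv ℝ χ q (0, 1))) := by
    funext q
    simp only [g, laplacianZX_eq_lineDeriv, gradDot]
    ring
  have t2 : (fun q => v q * gradDot u χ q - u q * gradDot v χ q) = fun q =>
      (lineDeriv ℝ u q (1, 0) * v q * lineDeriv ℝ χ q (1, 0)
        - u q * lineDeriv ℝ v q (1, 0) * lineDeriv ℝ χ q (1, 0))
      + (lineDeriv ℝ u q (0, 1) * v q * lineDeriv ℝ χ q (0, 1)
        - u q * lineDeriv ℝ v q (0, 1) * lineDeriv ℝ χ q (0, 1)) := by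
    funext q
    simp only [gradDot]
    ring
  have k4 (e : ℝ × ℝ) := ((k1 e).add ((k2 e).const_mul 2)).neg
  have k5 (e : ℝ × ℝ) := (k3 e).sub (k2 e)
  rw [t1, t2]
  refine ⟨(k5 _).add (k5 _), ?_⟩
  refine (integral_add (k4 _) (k4 _)).trans (Eq.trans ?_ (integral_add (k5 _) (k5 _)).symm)
  exact congrArg₂ (· + ·) (key' _) (key' _)

/-! ### Pairings in `L²` -/

section Pairing

variable {α : Type*} [MeasurableSpace α] {μ : Measure α}

/-- Hölder's inequality for the bilinear pairing, without conjugation. -/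
theorem tendsto_integral_mul_of_tendsto_eLpNorm {A f : α → ℂ} {fn : ℕ → α → ℂ}
    (hA : MemLp A 2 μ) (hf : MemLp f 2 μ) (hfn : ∀ n, MemLp (fn n) 2 μ)
    (h : Tendsto (fun n => eLpNorm (fun x => f x - fn n x) 2 μ) atTop (𝓝 0)) :
    Tendsto (fun n => ∫ x, A x * fn n x ∂μ) atTop (𝓝 (∫ x, A x * f x ∂μ)) := by
  rw [tendsto_iff_edist_tendsto_0]
  have hb : Tendsto (fun n => eLpNorm A 2 μ * eLpNorm (fun x => f x - fn n x) 2 μ) atTop (𝓝 0) := by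
    simpa using ENNReal.Tendsto.const_mul h (Or.inr hA.2.ne)
  refine tendsto_of_tendsto_of_tendsto_of_le_of_le tendsto_const_nhds hb (fun _ => zero_le)
    fun n => ?_
  have hs := eLpNorm_smul_le_mul_eLpNorm (p := 2) (q := 2) (r := 1) (hf.sub (hfn n)).1 hA.1
  have hi : (∫ x, A x * f x ∂μ) - ∫ x, A x * fn n x ∂μ = ∫ x, (A x * f x - A x * fn n x) ∂μ :=
    (integral_sub (hA.integrable_mul hf) (hA.integrable_mul (hfn n))).symm
  rw [edist_comm, edist_eq_enorm_sub, hi]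
  refine (enorm_integral_le_lintegral_enorm _).trans (le_trans (le_of_eq ?_) hs)
  rw [eLpNorm_one_eq_lintegral_enorm]
  simp [mul_sub]

end Pairing

/-! ### Functions of finite energy -/

/-- Functions with square integrable values and first derivatives on `S`. -/
structure HasFiniteEnergy (S : Set (ℝ × ℝ)) (u : ℝ × ℝ → ℂ) : Prop where
  memLp : MemLp u 2 (volume.restrict S)
  memLp_lineDeriv_z : MemLp (fun q => lineDeriv ℝ u q (1, 0)) 2 (volume.restrict S)
  memLp_lineDeriv_x : MemLp (fun q => lineDeriv ℝ u q (0, 1)) 2 (volume.restrict S)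

theorem HasFiniteEnergy.mono {S S' : Set (ℝ × ℝ)} {u : ℝ × ℝ → ℂ} (h : HasFiniteEnergy S u)
    (hS : S' ⊆ S) : HasFiniteEnergy S' u :=
  ⟨h.memLp.mono_measure (Measure.restrict_mono_set _ hS),
    h.memLp_lineDeriv_z.mono_measure (Measure.restrict_mono_set _ hS),
    h.memLp_lineDeriv_x.mono_measure (Measure.restrict_mono_set _ hS)⟩

theorem IsTestFunction.memLp {V : Set (ℝ × ℝ)} {φ : ℝ × ℝ → ℂ} (hφ : IsTestFunction V φ)
    (p : ℝ≥0∞) (μ : Measure (ℝ × ℝ)) [IsFiniteMeasureOnCompacts μ] : MemLp φ p μ :=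
  hφ.continuous.memLp_of_hasCompactSupport hφ.2.1

theorem IsTestFunction.hasFiniteEnergy {V : Set (ℝ × ℝ)} {φ : ℝ × ℝ → ℂ}
    (hφ : IsTestFunction V φ) (S : Set (ℝ × ℝ)) : HasFiniteEnergy S φ :=
  ⟨hφ.memLp _ _, (hφ.lineDerivative _).memLp _ _, (hφ.lineDerivative _).memLp _ _⟩

theorem eLpNorm_two_le_of_lintegral_le {S : Set (ℝ × ℝ)} {f : ℝ × ℝ → ℂ} {F : ℝ × ℝ → ℝ≥0∞}
    (h : ∀ q, ‖f q‖ₑ ^ 2 ≤ F q) :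
    eLpNorm f 2 (volume.restrict S) ≤ (∫⁻ q in S, F q) ^ (1 / 2 : ℝ) := by
  rw [eLpNorm_eq_lintegral_rpow_enorm_toReal two_ne_zero ENNReal.ofNat_ne_top]
  simp only [ENNReal.toReal_ofNat, ENNReal.rpow_ofNat]
  exact ENNReal.rpow_le_rpow (lintegral_mono h) (by norm_num)

theorem eLpNorm_sub_le_sobolevDistSq (S : Set (ℝ × ℝ)) (u v : ℝ × ℝ → ℂ) :
    eLpNorm (fun q => u q - v q) 2 (volume.restrict S) ≤ sobolevDistSq S u v ^ (1 / 2 : ℝ) :=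
  eLpNorm_two_le_of_lintegral_le fun q => by
    rw [add_assoc]
    exact le_self_add

theorem eLpNorm_lineDeriv_z_sub_le_sobolevDistSq (S : Set (ℝ × ℝ)) (u v : ℝ × ℝ → ℂ) :
    eLpNorm (fun q => lineDeriv ℝ u q (1, 0) - lineDeriv ℝ v q (1, 0)) 2 (volume.restrict S)
      ≤ sobolevDistSq S u v ^ (1 / 2 : ℝ) :=
  eLpNorm_two_le_of_lintegral_le fun q => by
    simp only [partialZ_eq_lineDeriv]
    exact le_add_right le_add_self

theorem eLpNorm_lineDeriv_x_sub_le_sobolevDistSq (S : Set (ℝ × ℝ)) (u v : ℝ × ℝ → ℂ) :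
    eLpNorm (fun q => lineDeriv ℝ u q (0, 1) - lineDeriv ℝ v q (0, 1)) 2 (volume.restrict S)
      ≤ sobolevDistSq S u v ^ (1 / 2 : ℝ) :=
  eLpNorm_two_le_of_lintegral_le fun q => by
    simp only [partialX_eq_lineDeriv]
    exact le_add_self

theorem memLp_of_eLpNorm_sub_lt_top {α : Type*} [MeasurableSpace α] {μ : Measure α}
    {f g : α → ℂ} (hf : AEStronglyMeasurable f μ) (hg : MemLp g 2 μ)
    (h : eLpNorm (fun x => f x - g x) 2 μ < ⊤) : MemLp f 2 μ := by
  have : MemLp (fun x => f x - g x) 2 μ := ⟨hf.sub hg.1, h⟩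
  simpa [Pi.add_def] using this.add hg

/-- Test functions have finite energy, and so does anything at finite distance from one. The C¹
regularity supplies the measurability that a finite `lintegral` does not give. -/
theorem hasFiniteEnergy_of_sobolevDistSq_lt_top {S V V' : Set (ℝ × ℝ)} {u v : ℝ × ℝ → ℂ}
    (hS : MeasurableSet S) (hV : IsOpen V) (hSV : S ⊆ V) (hu : ContDiffOn ℝ 1 u V)
    (hv : IsTestFunction V' v) (h : sobolevDistSq S u v < ⊤) : HasFiniteEnergy S u := by
  have hr : sobolevDistSq S u v ^ (1 / 2 : ℝ) < ⊤ := ENNReal.rpow_lt_top_of_nonneg (by norm_num) h.ne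
  have hv' := hv.hasFiniteEnergy S
  have hm (e : ℝ × ℝ) :
      AEStronglyMeasurable (fun q => lineDeriv ℝ u q e) (volume.restrict S) :=
    ((hu.continuousOn_lineDeriv e hV).mono hSV).aestronglyMeasurable hS
  exact ⟨memLp_of_eLpNorm_sub_lt_top ((hu.continuousOn.mono hSV).aestronglyMeasurable hS)
      hv'.memLp ((eLpNorm_sub_le_sobolevDistSq S u v).trans_lt hr),
    memLp_of_eLpNorm_sub_lt_top (hm _) hv'.memLp_lineDeriv_z
      ((eLpNorm_lineDeriv_z_sub_le_sobolevDistSq S u v).trans_lt hr),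
    memLp_of_eLpNorm_sub_lt_top (hm _) hv'.memLp_lineDeriv_x
      ((eLpNorm_lineDeriv_x_sub_le_sobolevDistSq S u v).trans_lt hr)⟩

theorem IsBoundedCoefficient.memLp_top {U S : Set (ℝ × ℝ)} {κ : ℝ × ℝ → ℝ}
    (hκ : IsBoundedCoefficient U κ) (hU : IsOpen U) (hSU : S ⊆ U) :
    MemLp (fun q => (κ q : ℂ)) ∞ (volume.restrict S) := by
  obtain ⟨H, hH⟩ := hκ.bounded
  refine memLp_top_of_bound
    (Complex.measurable_ofReal.comp hκ.measurable).aestronglyMeasurable H ?_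
  refine ae_mono (Measure.restrict_mono_set _ hSU) ?_
  filter_upwards [ae_restrict_mem hU.measurableSet] with q hq
  simpa using hH q hq

theorem tendsto_rpow_half_of_tendsto {ι : Type*} {l : Filter ι} {s t : ι → ℝ≥0∞}
    (hs : Tendsto s l (𝓝 0)) (h : ∀ i, t i ≤ s i ^ (1 / 2 : ℝ)) : Tendsto t l (𝓝 0) := by
  have h1 : Tendsto (fun i => s i ^ (1 / 2 : ℝ)) l (𝓝 0) := by
    simpa using hs.ennrpow_const (1 / 2 : ℝ)
  exact tendsto_of_tendsto_of_tendsto_of_le_of_le tendsto_const_nhds h1 (fun _ => zero_le) h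

/-! ### The boundary trace on a strip -/

theorem memLp_strip_mul {a b c d : ℝ} {f : ℝ → ℂ} {τ : ℝ → ℝ}
    (hf : MemLp f 2 (volume.restrict (Ioo c d))) (hτ : Continuous τ) :
    MemLp (fun q : ℝ × ℝ => f q.2 * (τ q.1 : ℂ)) 2 (volume.restrict (Ioo a b ×ˢ Ioo c d)) := by
  rw [Measure.volume_eq_prod, ← Measure.prod_restrict]
  have h1 : MemLp (fun q : ℝ × ℝ => f q.2) 2
      ((volume.restrict (Ioo a b)).prod (volume.restrict (Ioo c d))) := hf.comp_snd _
  obtain ⟨C, hC⟩ := isCompact_Icc.exists_bound_of_continuousOn (hτ.continuousOn (s := Icc a b))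
  have h2 : MemLp (fun q : ℝ × ℝ => (τ q.1 : ℂ)) ⊤
      ((volume.restrict (Ioo a b)).prod (volume.restrict (Ioo c d))) := by
    refine memLp_top_of_bound (by fun_prop) C ?_
    rw [Measure.prod_restrict]
    filter_upwards [ae_restrict_mem (measurableSet_Ioo.prod measurableSet_Ioo)] with q hq
    simpa using hC q.1 (Ioo_subset_Icc_self hq.1)
  exact h2.mul' h1

/-- The fundamental theorem of calculus for g times the affine weight that is 1 at a and 0 at b. -/
theorem trace_eq_integral {a b : ℝ} (hab : a < b) {g : ℝ → ℂ} (hg : ContDiffOn ℝ 1 g (Icc a b)) :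
    ∫ z in Ioo a b, (((b - a)⁻¹ : ℝ) * g z - ((b - z) * (b - a)⁻¹ : ℝ) * deriv g z) = g a := by
  have hP : ContDiffOn ℝ 1 (fun z => (((b - z) * (b - a)⁻¹ : ℝ) : ℂ) * g z) (Icc a b) := by
    refine ContDiffOn.mul (ContDiff.contDiffOn ?_) hg
    exact Complex.ofRealCLM.contDiff.comp ((contDiff_const.sub contDiff_id).mul contDiff_const)
  have h := intervalIntegral.integral_deriv_of_contDiffOn_Icc hP hab.le
  rw [intervalIntegral.integral_of_le hab.le, integral_Ioc_eq_integral_Ioo] at h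
  have hne : b - a ≠ 0 := by linarith
  simp only [sub_self, zero_mul, Complex.ofReal_zero, mul_inv_cancel₀ hne, Complex.ofReal_one,
    one_mul, zero_sub] at h
  rw [← neg_inj, ← h, ← integral_neg]
  refine setIntegral_congr_fun measurableSet_Ioo fun z hz => ?_
  have h1 : HasDerivAt g (deriv g z) z :=
    ((hg.contDiffAt (Icc_mem_nhds hz.1 hz.2)).differentiableAt one_ne_zero).hasDerivAt
  have h2 : HasDerivAt (fun z : ℝ => (((b - z) * (b - a)⁻¹ : ℝ) : ℂ))
      ((-1 * (b - a)⁻¹ : ℝ) : ℂ) z :=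
    (((hasDerivAt_id z).const_sub b).mul_const (b - a)⁻¹).ofReal_comp
  have h3 := (h2.fun_mul h1).deriv
  rw [h3]
  push_cast
  ring

/-- The pairing of a function of the cross-range with the trace at `z = a` is a bounded pairing
over the strip `(a, b) × (c, d)`. -/
theorem integral_mul_trace_eq {a b c d : ℝ} (hab : a < b) {f : ℝ → ℂ} {w : ℝ × ℝ → ℂ}
    (hf : MemLp f 2 (volume.restrict (Ioo c d)))
    (hw : ∀ x ∈ Ioo c d, ContDiffOn ℝ 1 (fun z => w (z, x)) (Icc a b))
    (hwe : HasFiniteEnergy (Ioo a b ×ˢ Ioo c d) w) :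
    ∫ x in Ioo c d, f x * w (a, x)
      = (∫ q in Ioo a b ×ˢ Ioo c d, f q.2 * ((b - a)⁻¹ : ℝ) * w q)
        - ∫ q in Ioo a b ×ˢ Ioo c d,
            f q.2 * ((b - q.1) * (b - a)⁻¹ : ℝ) * lineDeriv ℝ w q (1, 0) := by
  have i1 := (memLp_strip_mul (a := a) (b := b) hf
    (continuous_const (y := (b - a)⁻¹))).integrable_mul hwe.memLp
  have i2 := (memLp_strip_mul (a := a) (b := b) hf
    (τ := fun z => (b - z) * (b - a)⁻¹) (by fun_prop)).integrable_mul hwe.memLp_lineDeriv_z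
  have i3 := i1.sub i2
  refine Eq.trans ?_ (integral_sub i1 i2)
  rw [Measure.volume_eq_prod, ← Measure.prod_restrict] at i3 ⊢
  refine Eq.trans ?_ (integral_prod_symm _ i3).symm
  refine setIntegral_congr_fun measurableSet_Ioo fun x hx => ?_
  rw [← trace_eq_integral hab (hw x hx), ← integral_const_mul]
  congr 1
  funext z
  have := congrFun (partialZ_eq_lineDeriv w) (z, x)
  simp only [Pi.sub_apply, Pi.mul_apply]
  rw [← this, partialZ]
  ring

/-- Rewriting the trace pairing over the strip makes it continuous under H¹ convergence. This
carries the boundary term from the approximations φₙ to the solution. -/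
theorem tendsto_integral_mul_trace {a b c d : ℝ} (hab : a < b) {f : ℝ → ℂ} {w : ℝ × ℝ → ℂ}
    {wn : ℕ → ℝ × ℝ → ℂ}
    (hf : MemLp f 2 (volume.restrict (Ioo c d)))
    (hw : ∀ x ∈ Ioo c d, ContDiffOn ℝ 1 (fun z => w (z, x)) (Icc a b))
    (hwn : ∀ n, IsTestFunction univ (wn n))
    (hwe : HasFiniteEnergy (Ioo a b ×ˢ Ioo c d) w)
    (h : Tendsto (fun n => sobolevDistSq (Ioo a b ×ˢ Ioo c d) w (wn n)) atTop (𝓝 0)) :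
    Tendsto (fun n => ∫ x in Ioo c d, f x * wn n (a, x)) atTop
      (𝓝 (∫ x in Ioo c d, f x * w (a, x))) := by
  have he (n : ℕ) := (hwn n).hasFiniteEnergy (Ioo a b ×ˢ Ioo c d)
  have hwn' (n : ℕ) : ∀ x ∈ Ioo c d, ContDiffOn ℝ 1 (fun z => wn n (z, x)) (Icc a b) :=
    fun x _ => ((hwn n).contDiff_one.comp (contDiff_prodMk_left x)).contDiffOn
  rw [integral_mul_trace_eq hab hf hw hwe]
  simp only [fun n => integral_mul_trace_eq hab hf (hwn' n) (he n)]
  exact (tendsto_integral_mul_of_tendsto_eLpNorm (memLp_strip_mul hf continuous_const)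
      hwe.memLp (fun n => (he n).memLp)
      (tendsto_rpow_half_of_tendsto h fun n => eLpNorm_sub_le_sobolevDistSq _ _ _)).sub
    (tendsto_integral_mul_of_tendsto_eLpNorm
      (memLp_strip_mul (τ := fun z => (b - z) * (b - a)⁻¹) hf (by fun_prop))
      hwe.memLp_lineDeriv_z (fun n => (he n).memLp_lineDeriv_z)
      (tendsto_rpow_half_of_tendsto h fun n => eLpNorm_lineDeriv_z_sub_le_sobolevDistSq _ _ _))

/-! ### Smooth cutoffs near the artificial boundary -/

/-- A smooth nondecreasing cutoff that vanishes for `z ≤ a + 1 / (n + 1)` and equals `1` for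
`a + 2 / (n + 1) ≤ z`. -/
noncomputable def boundaryCutoff (a : ℝ) (n : ℕ) (z : ℝ) : ℝ := Real.smoothTransition ((n + 1) * (z - a) - 1)

theorem contDiff_boundaryCutoff (a : ℝ) (n : ℕ) {m : ℕ∞} : ContDiff ℝ m (boundaryCutoff a n) :=
  Real.smoothTransition.contDiff.comp
    ((contDiff_const.mul (contDiff_id.sub contDiff_const)).sub contDiff_const)

theorem monotone_boundaryCutoff (a : ℝ) (n : ℕ) : Monotone (boundaryCutoff a n) := by
  intro z w h
  apply Real.smoothTransition.monotone
  have : (0 : ℝ) ≤ n + 1 := by positivity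
  nlinarith [mul_le_mul_of_nonneg_left h this]

theorem boundaryCutoff_of_le {a z : ℝ} {n : ℕ} (h : z ≤ a + 1 / (n + 1)) :
    boundaryCutoff a n z = 0 := by
  apply Real.smoothTransition.zero_of_nonpos
  have hn : (0 : ℝ) < n + 1 := by positivity
  have : (z - a) * (n + 1) ≤ 1 := (le_div_iff₀ hn).1 (by linarith)
  linarith

theorem boundaryCutoff_of_ge {a z : ℝ} {n : ℕ} (h : a + 2 / (n + 1) ≤ z) :
    boundaryCutoff a n z = 1 := by
  apply Real.smoothTransition.one_of_one_le
  have hn : (0 : ℝ) < n + 1 := by positivity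
  have : 2 ≤ (z - a) * (n + 1) := (div_le_iff₀ hn).1 (by linarith)
  linarith

theorem deriv_boundaryCutoff_of_gt {a z : ℝ} {n : ℕ} (h : a + 2 / (n + 1) < z) :
    deriv (boundaryCutoff a n) z = 0 := by
  have : boundaryCutoff a n =ᶠ[𝓝 z] fun _ => 1 := by
    filter_upwards [lt_mem_nhds h] with w hw
    exact boundaryCutoff_of_ge hw.le
  rw [this.deriv_eq, deriv_const]

theorem eventually_two_div_lt {ε : ℝ} (hε : 0 < ε) : ∀ᶠ n : ℕ in atTop, 2 / ((n : ℝ) + 1) < ε := by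
  have h := (tendsto_const_div_atTop_nhds_zero_nat (2 : ℝ)).comp (tendsto_add_atTop_nat 1)
  filter_upwards [h.eventually_lt_const hε] with n hn
  simpa using hn

theorem tendsto_boundaryCutoff {a z : ℝ} (h : a < z) :
    Tendsto (fun n => boundaryCutoff a n z) atTop (𝓝 1) := by
  refine tendsto_const_nhds.congr' ?_
  filter_upwards [eventually_two_div_lt (sub_pos.2 h)] with n hn
  exact (boundaryCutoff_of_ge (by linarith)).symm

theorem continuous_deriv_boundaryCutoff (a : ℝ) (n : ℕ) :
    Continuous (deriv (boundaryCutoff a n)) :=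
  (contDiff_boundaryCutoff a n (m := 1)).continuous_deriv le_rfl

/-- The derivatives of the cutoffs are a one-sided approximate identity at a: nonnegative,
eventually of total mass 1 on (a, b), and supported ever closer to a. -/
theorem tendsto_integral_deriv_boundaryCutoff {a b : ℝ} (hab : a < b) {J : ℝ → ℂ}
    (hJ : Continuous J) :
    Tendsto (fun n => ∫ z in Ioo a b, deriv (boundaryCutoff a n) z • J z) atTop (𝓝 (J a)) := by
  refine tendsto_setIntegral_peak_smul_of_integrableOn_of_tendsto (x₀ := a) measurableSet_Ioo
    measurableSet_Ioo subset_rfl self_mem_nhdsWithin measure_Ioo_lt_top.ne ?_ ?_ ?_ ?_ ?_ ?_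
  · exact Eventually.of_forall fun n z _ => (monotone_boundaryCutoff a n).deriv_nonneg
  · intro u hu hau
    obtain ⟨ε, hε, hεu⟩ := Metric.isOpen_iff.1 hu a hau
    refine Metric.tendstoUniformlyOn_iff.2 fun η hη => ?_
    filter_upwards [eventually_two_div_lt hε] with n hn z hz
    have hz' : a + ε ≤ z := by
      by_contra hlt
      refine hz.2 (hεu ?_)
      rw [Metric.mem_ball, Real.dist_eq, abs_of_pos (by linarith [hz.1.1])]
      linarith
    rw [deriv_boundaryCutoff_of_gt (by linarith)]
    simpa using hη
  · refine tendsto_const_nhds.congr' ?_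
    filter_upwards [eventually_two_div_lt (sub_pos.2 hab)] with n hn
    rw [← integral_Ioc_eq_integral_Ioo, ← intervalIntegral.integral_of_le hab.le,
      intervalIntegral.integral_deriv_eq_sub
        (fun z _ => (contDiff_boundaryCutoff a n (m := 1)).differentiable (by simp) z)
        ((continuous_deriv_boundaryCutoff a n).intervalIntegrable _ _),
      boundaryCutoff_of_ge (by linarith), boundaryCutoff_of_le (by simp; positivity), sub_zero]
  · exact Eventually.of_forall fun n => (continuous_deriv_boundaryCutoff a n).aestronglyMeasurable
  · exact (hJ.continuousOn.integrableOn_Icc).mono_set Ioo_subset_Icc_self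
  · exact (hJ.tendsto a).mono_left nhdsWithin_le_nhds

theorem tendsto_integral_boundary_layer {a b c d : ℝ} (hab : a < b) (hcd : c ≤ d) {F : ℝ × ℝ → ℂ}
    (hF : ContinuousOn F (Icc a b ×ˢ Icc c d)) :
    Tendsto (fun n => ∫ q in Ioo a b ×ˢ Ioo c d, ((deriv (boundaryCutoff a n) q.1 : ℝ) : ℂ) * F q)
      atTop (𝓝 (∫ x in Ioo c d, F (a, x))) := by
  -- Clamping the arguments to the rectangle extends F continuously to the plane, so that its
  -- cross-range integrals depend continuously on z.
  set F' : ℝ → ℝ → ℂ := fun z x => F (max a (min b z), max c (min d x)) with hF'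
  have hF'c : Continuous (Function.uncurry F') := by
    refine hF.comp_continuous (by fun_prop) fun q => ⟨⟨le_max_left _ _, ?_⟩, le_max_left _ _, ?_⟩
    · exact max_le hab.le (min_le_left _ _)
    · exact max_le hcd (min_le_left _ _)
  have hFF {z x : ℝ} (hz : z ∈ Icc a b) (hx : x ∈ Icc c d) : F' z x = F (z, x) := by
    simp [hF', min_eq_right hz.2, max_eq_right hz.1, min_eq_right hx.2, max_eq_right hx.1]
  have hJ : Continuous fun z => ∫ x in c..d, F' z x :=
    intervalIntegral.continuous_parametric_intervalIntegral_of_continuous' hF'c c d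
  have hlim := tendsto_integral_deriv_boundaryCutoff hab hJ
  have hend : ∫ x in c..d, F' a x = ∫ x in Ioo c d, F (a, x) := by
    rw [intervalIntegral.integral_of_le hcd, integral_Ioc_eq_integral_Ioo]
    exact setIntegral_congr_fun measurableSet_Ioo fun x hx =>
      hFF (left_mem_Icc.2 hab.le) (Ioo_subset_Icc_self hx)
  rw [hend] at hlim
  refine hlim.congr fun n => ?_
  have hint : IntegrableOn (fun q : ℝ × ℝ => ((deriv (boundaryCutoff a n) q.1 : ℝ) : ℂ) * F q)
      (Ioo a b ×ˢ Ioo c d) := by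
    refine IntegrableOn.mono_set (ContinuousOn.integrableOn_compact
      (isCompact_Icc.prod isCompact_Icc) (ContinuousOn.mul ?_ hF))
      (prod_mono Ioo_subset_Icc_self Ioo_subset_Icc_self)
    exact (Complex.continuous_ofReal.comp
      ((continuous_deriv_boundaryCutoff a n).comp continuous_fst)).continuousOn
  rw [Measure.volume_eq_prod] at hint ⊢
  rw [setIntegral_prod _ hint]
  refine setIntegral_congr_fun measurableSet_Ioo fun z hz => ?_
  simp only
  rw [integral_const_mul, intervalIntegral.integral_of_le hcd, integral_Ioc_eq_integral_Ioo,
    Complex.real_smul]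
  congr 1
  exact setIntegral_congr_fun measurableSet_Ioo fun x hx =>
    hFF (Ioo_subset_Icc_self hz) (Ioo_subset_Icc_self hx)

namespace TerminatingWaveguide

variable (W : TerminatingWaveguide) {freq za r : ℝ} {M : ℕ} {y : ℝ × ℝ} {u φ : ℝ × ℝ → ℂ}

/-! ### Solutions in the truncated waveguide -/

/-- The coefficient `k² η` of the Helmholtz equation. -/
noncomputable def coefficient (freq : ℝ) (q : ℝ × ℝ) : ℝ := W.k freq ^ 2 * W.η q

theorem isOpen_truncated (za : ℝ) : IsOpen (W.truncated za) :=
  W.isOpen_Ω.inter (isOpen_lt continuous_const continuous_fst)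

theorem mem_truncated_iff {q : ℝ × ℝ} : q ∈ W.truncated za ↔ q ∈ W.Ω ∧ za < q.1 := Iff.rfl

theorem mem_truncatedWithA_iff {q : ℝ × ℝ} : q ∈ W.truncatedWithA za ↔ q ∈ W.Ω ∧ za ≤ q.1 :=
  Iff.rfl

theorem truncated_subset_truncatedWithA (za : ℝ) : W.truncated za ⊆ W.truncatedWithA za :=
  fun _ hq => (W.mem_truncatedWithA_iff).2 ⟨hq.1, ((W.mem_truncated_iff).1 hq).2.le⟩

theorem mem_Ω_iff {q : ℝ × ℝ} (hq : q.1 < W.L) : q ∈ W.Ω ↔ q.2 ∈ Ioo 0 W.D := by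
  have h := Set.ext_iff.1 W.strip_eq q
  simp only [mem_inter_iff, mem_ofPred_eq, mem_prod, mem_Iio, hq, and_true, true_and] at h
  exact h

theorem isBoundedCoefficient (freq za : ℝ) :
    IsBoundedCoefficient (W.truncated za) (W.coefficient freq) := by
  refine ⟨measurable_const.mul (measurable_const.div (W.measurable_c.pow_const 2)), ?_⟩
  obtain ⟨m, hm, hc⟩ := W.c_lower
  refine ⟨W.k freq ^ 2 * (W.c₀ ^ 2 / m ^ 2), fun q hq => ?_⟩
  have h := hc q hq.1
  have hη : 0 ≤ W.η q := by unfold η; positivity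
  rw [coefficient, abs_of_nonneg (mul_nonneg (sq_nonneg _) hη)]
  refine mul_le_mul_of_nonneg_left ?_ (sq_nonneg _)
  unfold η
  gcongr

variable {W}

theorem SolvesPointSource.isPointSourceSolution (hu : W.SolvesPointSource freq M za y u) :
    IsPointSourceSolution (W.truncated za) (W.coefficient freq) y u :=
  ⟨hu.contDiffOn.mono (sdiff_subset_sdiff_left (W.truncated_subset_truncatedWithA za)),
    hu.locallyIntegrableOn, hu.helmholtz⟩

theorem SolvesPointSource.hasFiniteEnergy (hu : W.SolvesPointSource freq M za y u) (hr : 0 < r) :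
    HasFiniteEnergy (W.truncated za \ Metric.ball y r) u := by
  obtain ⟨v, hv, hlt⟩ := hu.dirichlet r hr 1 one_pos
  refine hasFiniteEnergy_of_sobolevDistSq_lt_top
    ((W.isOpen_truncated za).measurableSet.diff Metric.isOpen_ball.measurableSet)
    ((W.isOpen_truncated za).sdiff isClosed_singleton) ?_ hu.isPointSourceSolution.contDiffOn hv
    (hlt.trans ENNReal.one_lt_top)
  exact sdiff_subset_sdiff_right (singleton_subset_iff.2 (Metric.mem_ball_self hr))

theorem uniqueDiffOn_truncatedWithA_diff (za : ℝ) (y : ℝ × ℝ) :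
    UniqueDiffOn ℝ (W.truncatedWithA za \ {y}) := by
  have h := ((uniqueDiffOn_Ici za).prod (uniqueDiffOn_univ (𝕜 := ℝ) (E := ℝ))).inter
    (W.isOpen_Ω.sdiff (isClosed_singleton (x := y)))
  convert h using 1
  ext q
  simp only [Set.mem_sdiff, mem_truncatedWithA_iff, mem_inter_iff, mem_prod, mem_Ici, mem_univ,
    and_true]
  tauto

/-- The range derivative up to the artificial boundary. -/
noncomputable def rangeDeriv (W : TerminatingWaveguide) (za : ℝ) (y : ℝ × ℝ) (u : ℝ × ℝ → ℂ) (q : ℝ × ℝ) : ℂ :=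
  fderivWithin ℝ u (W.truncatedWithA za \ {y}) q (1, 0)

theorem SolvesPointSource.continuousOn_rangeDeriv (hu : W.SolvesPointSource freq M za y u) :
    ContinuousOn (W.rangeDeriv za y u) (W.truncatedWithA za \ {y}) :=
  (hu.contDiffOn.continuousOn_fderivWithin (uniqueDiffOn_truncatedWithA_diff za y)
    le_rfl).clm_apply continuousOn_const

theorem SolvesPointSource.rangeDeriv_eq (hu : W.SolvesPointSource freq M za y u) {q : ℝ × ℝ}
    (hq : q ∈ W.truncated za \ {y}) : W.rangeDeriv za y u q = lineDeriv ℝ u q (1, 0) := by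
  have hV := ((W.isOpen_truncated za).sdiff (isClosed_singleton (x := y))).mem_nhds hq
  have hn : W.truncatedWithA za \ {y} ∈ 𝓝 q :=
    mem_of_superset hV (sdiff_subset_sdiff_left (W.truncated_subset_truncatedWithA za))
  rw [rangeDeriv, fderivWithin_of_mem_nhds hn]
  exact ((hu.contDiffOn.contDiffAt hn).differentiableAt one_ne_zero).lineDeriv_eq_fderiv.symm

theorem mem_truncatedWithA_diff (hza : za < W.L) (hy : y ∈ W.truncated za) {x : ℝ}
    (hx : x ∈ Ioo 0 W.D) : (za, x) ∈ W.truncatedWithA za \ {y} := by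
  refine ⟨⟨(W.mem_Ω_iff (q := (za, x)) hza).2 hx, le_refl za⟩, ?_⟩
  rintro rfl
  exact lt_irrefl _ (W.mem_truncated_iff.1 hy).2

/-- Identifies the one-sided derivative in the radiation condition with the limit of interior range
derivatives, which is what the boundary layer integrals produce. -/
theorem SolvesPointSource.normalDerivA_eq (hu : W.SolvesPointSource freq M za y u)
    (hza : za < W.L) (hy : y ∈ W.truncated za) {x : ℝ} (hx : x ∈ Ioo 0 W.D) :
    normalDerivA za u x = -W.rangeDeriv za y u (za, x) := by
  have hmem := mem_truncatedWithA_diff hza hy hx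
  have h1 := (hu.contDiffOn.differentiableOn one_ne_zero _ hmem).hasFDerivWithinAt
  have h2 : HasDerivWithinAt (fun z : ℝ => (z, x)) ((1 : ℝ), (0 : ℝ))
      ((fun z : ℝ => (z, x)) ⁻¹' (W.Ω \ {y}) ∩ Ici za) za :=
    ((hasDerivAt_id za).prodMk (hasDerivAt_const za x)).hasDerivWithinAt
  have h3 := h1.comp_hasDerivWithinAt (x := za) (f := fun z : ℝ => (z, x)) h2
    fun z hz => ⟨⟨hz.1.1, hz.2⟩, hz.1.2⟩
  have hO : IsOpen ((fun z : ℝ => (z, x)) ⁻¹' (W.Ω \ {y})) :=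
    (W.isOpen_Ω.sdiff isClosed_singleton).preimage (by fun_prop)
  have h4 : HasDerivWithinAt (fun z => u (z, x)) (W.rangeDeriv za y u (za, x)) (Ici za) za := by
    refine h3.mono_of_mem_nhdsWithin ?_
    exact inter_mem (mem_nhdsWithin_of_mem_nhds (hO.mem_nhds ⟨hmem.1.1, hmem.2⟩))
      self_mem_nhdsWithin
  rw [normalDerivA, h4.derivWithin (uniqueDiffOn_Ici za za self_mem_Ici)]

theorem SolvesPointSource.integrableOn_gradDot_sub (hu : W.SolvesPointSource freq M za y u)
    (hr : 0 < r) (hφ : IsTestFunction W.Ω φ) (hφr : ∀ q ∈ Metric.ball y r, φ q = 0) :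
    IntegrableOn (fun q => gradDot u φ q - (W.coefficient freq q : ℂ) * (u q * φ q))
      (W.truncated za) := by
  have hU := W.isOpen_truncated za
  have he := hu.hasFiniteEnergy hr
  have hφe := hφ.hasFiniteEnergy (W.truncated za \ Metric.ball y r)
  have hS : IntegrableOn (fun q => gradDot u φ q - (W.coefficient freq q : ℂ) * (u q * φ q))
      (W.truncated za \ Metric.ball y r) := by
    have i0 := (W.isBoundedCoefficient freq za).integrableOn_mul hU sdiff_subset
      (he.memLp.integrable_mul hφe.memLp)
    exact ((he.memLp_lineDeriv_z.integrable_mul hφe.memLp_lineDeriv_z).add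
      (he.memLp_lineDeriv_x.integrable_mul hφe.memLp_lineDeriv_x)).sub i0
  refine hS.of_forall_sdiff_eq_zero hU.measurableSet fun q hq => ?_
  have hqb : q ∈ Metric.ball y r := by
    by_contra h
    exact hq.2 ⟨hq.1, h⟩
  have hev : φ =ᶠ[𝓝 q] fun _ => 0 := by
    filter_upwards [Metric.isOpen_ball.mem_nhds hqb] with p hp
    exact hφr p hp
  simp [gradDot, lineDeriv_of_eventuallyEq_const _ hev, hφr q hqb]

/-- The variational form of the boundary value problem, tested with functions that vanish near the
source and on the walls, but not on the artificial boundary. -/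
theorem SolvesPointSource.integral_gradDot_sub (hu : W.SolvesPointSource freq M za y u)
    (hza : za < W.L) (hy : y ∈ W.truncated za) (hr : 0 < r) (hφ : IsTestFunction W.Ω φ)
    (hφr : ∀ q ∈ Metric.ball y r, φ q = 0) :
    ∫ q in W.truncated za, (gradDot u φ q - (W.coefficient freq q : ℂ) * (u q * φ q))
      = ∫ x in Ioo 0 W.D, normalDerivA za u x * φ (za, x) := by
  have hU := W.isOpen_truncated za
  have hκ := W.isBoundedCoefficient freq za
  have hs := hu.isPointSourceSolution
  have hV : IsOpen (W.truncated za \ {y}) := hU.sdiff isClosed_singleton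
  set g : ℝ × ℝ → ℂ := fun q => gradDot u φ q - (W.coefficient freq q : ℂ) * (u q * φ q) with hg
  have hgi : IntegrableOn g (W.truncated za) := hu.integrableOn_gradDot_sub hr hφ hφr
  have hyφ : y ∉ tsupport φ := by
    rw [notMem_tsupport_iff_eventuallyEq]
    filter_upwards [Metric.ball_mem_nhds y hr] with q hq
    exact hφr q hq
  -- Multiplication by Θ makes φ vanish near the artificial boundary, so the interior variational
  -- equation applies. The boundary term then emerges from the derivative of Θ as the layer shrinks.
  set Θ : ℕ → ℝ × ℝ → ℂ := fun n q => (boundaryCutoff za n q.1 : ℂ) with hΘ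
  have hΘc (n : ℕ) : ContDiff ℝ ∞ (Θ n) :=
    Complex.ofRealCLM.contDiff.comp ((contDiff_boundaryCutoff za n).comp contDiff_fst)
  have hΘφ (n : ℕ) : IsTestFunction (W.truncated za \ {y}) fun q => Θ n q * φ q := by
    refine ⟨(hΘc n).mul hφ.1, hφ.2.1.mul_left, fun q hq => ?_⟩
    have h1 := tsupport_mul_right_subset _ _ hq
    have hcl : IsClosed {q : ℝ × ℝ | za + 1 / (n + 1) ≤ q.1} :=
      isClosed_le continuous_const continuous_fst
    have h2 : tsupport (Θ n) ⊆ {q : ℝ × ℝ | za + 1 / (n + 1) ≤ q.1} := by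
      refine closure_minimal (fun p hp => ?_) hcl
      by_contra h
      refine hp ?_
      simp only [hΘ, boundaryCutoff_of_le (not_le.1 h).le, Complex.ofReal_zero]
    have h3 := h2 (tsupport_mul_left_subset _ _ hq)
    have h4 : (0 : ℝ) < 1 / (n + 1) := by positivity
    refine ⟨⟨hφ.2.2 h1, ?_⟩, ?_⟩
    · have : za + 1 / ((n : ℝ) + 1) ≤ q.1 := h3
      change za < q.1
      linarith
    · rintro rfl
      exact hyφ h1
  set R : ℕ → ℝ × ℝ → ℂ := fun n q =>
    ((deriv (boundaryCutoff za n) q.1 : ℝ) : ℂ) * (lineDeriv ℝ u q (1, 0) * φ q) with hR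
  have hΘd (n : ℕ) (q : ℝ × ℝ) : gradDot u (Θ n) q
      = lineDeriv ℝ u q (1, 0) * ((deriv (boundaryCutoff za n) q.1 : ℝ) : ℂ) := by
    have h1 : lineDeriv ℝ (Θ n) q (1, 0) = ((deriv (boundaryCutoff za n) q.1 : ℝ) : ℂ) := by
      rw [← congrFun (partialZ_eq_lineDeriv (Θ n)) q]
      exact (((contDiff_boundaryCutoff za n (m := 1)).differentiable
        (by simp) q.1).hasDerivAt.ofReal_comp).deriv
    have h2 : lineDeriv ℝ (Θ n) q (0, 1) = 0 := by
      rw [← congrFun (partialX_eq_lineDeriv (Θ n)) q]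
      simp [partialX, hΘ]
    rw [gradDot, h1, h2, mul_zero, add_zero]
  have hRn (n : ℕ) : ∫ q in W.truncated za, R n q = -∫ q in W.truncated za, Θ n q * g q := by
    have hw := hs.integral_gradDot hU hκ (hΘφ n)
    have i1 : IntegrableOn (gradDot u fun q => Θ n q * φ q) (W.truncated za) :=
      ((hΘφ n).integrable_gradDot hV hs.contDiffOn).integrableOn
    have i2 : IntegrableOn (fun q => (W.coefficient freq q : ℂ) * (u q * (Θ n q * φ q)))
        (W.truncated za) := hκ.integrableOn_mul hU subset_rfl
      ((hΘφ n).integrable_mul hV hs.contDiffOn.continuousOn).integrableOn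
    have i3 : IntegrableOn (fun q => Θ n q * g q) (W.truncated za) := by
      refine Integrable.bdd_mul (c := 1) hgi (hΘc n).continuous.aestronglyMeasurable ?_
      refine Eventually.of_forall fun q => ?_
      rw [Complex.norm_real, Real.norm_eq_abs, boundaryCutoff,
        abs_of_nonneg (Real.smoothTransition.nonneg _)]
      exact Real.smoothTransition.le_one _
    rw [← setIntegral_eq_integral_of_forall_compl_eq_zero (s := W.truncated za) fun q hq =>
      ((hΘφ n).mono sdiff_subset).gradDot_eq_zero hq] at hw
    have e1 : ∫ q in W.truncated za, R n q = ∫ q in W.truncated za,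
        ((gradDot u (fun q => Θ n q * φ q) q
          - (W.coefficient freq q : ℂ) * (u q * (Θ n q * φ q))) - Θ n q * g q) := by
      congr 1
      funext q
      rw [gradDot_mul_right ((hΘc n).differentiable (by simp) q)
        (hφ.contDiff_one.differentiable one_ne_zero q), hΘd]
      simp only [hR, hg]
      ring
    have e2 := integral_sub (i1.sub i2) i3
    have e3 := integral_sub i1 i2
    simp only [Pi.sub_apply] at e2
    rw [e1, e2, e3, hw, sub_self, zero_sub]
  have hlim1 : Tendsto (fun n => ∫ q in W.truncated za, Θ n q * g q) atTop
      (𝓝 (∫ q in W.truncated za, g q)) := by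
    refine tendsto_integral_of_dominated_convergence (fun q => ‖g q‖) (fun n => ?_) hgi.norm
      (fun n => Eventually.of_forall fun q => ?_) ?_
    · exact (hΘc n).continuous.aestronglyMeasurable.mul hgi.1
    · rw [norm_mul]
      refine mul_le_of_le_one_left (norm_nonneg _) ?_
      rw [Complex.norm_real, Real.norm_eq_abs, boundaryCutoff,
        abs_of_nonneg (Real.smoothTransition.nonneg _)]
      exact Real.smoothTransition.le_one _
    · filter_upwards [ae_restrict_mem hU.measurableSet] with q hq
      have h1 : Tendsto (fun n => Θ n q) atTop (𝓝 ((1 : ℝ) : ℂ)) :=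
        (Complex.continuous_ofReal.tendsto _).comp (tendsto_boundaryCutoff hq.2)
      simpa using h1.mul_const (g q)
  obtain ⟨b, hb, hbL⟩ := exists_between hza
  -- The derivative within the domain is used because the two-sided `lineDeriv` at `za` would see
  -- values of u to the left of it.
  set F : ℝ × ℝ → ℂ := fun q => W.rangeDeriv za y u q * φ q with hF
  -- The closed rectangle meets the walls, and possibly the source, where u is not controlled; φ
  -- vanishes near those points.
  have hFc : ContinuousOn F (Icc za b ×ˢ Icc 0 W.D) := by
    intro q hq
    by_cases hqφ : q ∈ tsupport φ
    · have hqΩ := hφ.2.2 hqφ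
      have hqy : q ≠ y := by
        rintro rfl
        exact hyφ hqφ
      have hc := (hu.continuousOn_rangeDeriv q ⟨⟨hqΩ, hq.1.1⟩, hqy⟩)
      refine ContinuousWithinAt.mul (hc.mono_of_mem_nhdsWithin ?_)
        hφ.continuous.continuousWithinAt
      have hO : W.Ω \ {y} ∈ 𝓝 q :=
        (W.isOpen_Ω.sdiff isClosed_singleton).mem_nhds ⟨hqΩ, hqy⟩
      filter_upwards [mem_nhdsWithin_of_mem_nhds hO, self_mem_nhdsWithin] with p hp hp'
      exact ⟨⟨hp.1, hp'.1.1⟩, hp.2⟩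
    · refine ContinuousAt.continuousWithinAt ?_
      refine (continuousAt_const (y := (0 : ℂ))).congr ?_
      filter_upwards [notMem_tsupport_iff_eventuallyEq.1 hqφ] with p hp
      simp [hF, hp]
  have hlim2 := tendsto_integral_boundary_layer hb W.D_pos.le hFc
  have hlim3 : Tendsto (fun n => ∫ q in W.truncated za, R n q) atTop
      (𝓝 (∫ x in Ioo 0 W.D, F (za, x))) := by
    refine hlim2.congr' ?_
    filter_upwards [eventually_two_div_lt (sub_pos.2 hb)] with n hn
    have hsub : Ioo za b ×ˢ Ioo 0 W.D ⊆ W.truncated za := fun q hq =>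
      ⟨(W.mem_Ω_iff (hq.1.2.trans hbL)).2 hq.2, hq.1.1⟩
    rw [setIntegral_eq_of_subset_of_forall_sdiff_eq_zero hU.measurableSet hsub]
    · refine setIntegral_congr_fun (measurableSet_Ioo.prod measurableSet_Ioo) fun q hq => ?_
      simp only [hR, hF]
      by_cases hqy : q = y
      · simp [hqy, image_eq_zero_of_notMem_tsupport hyφ]
      · rw [hu.rangeDeriv_eq ⟨hsub hq, hqy⟩]
    · intro q hq
      have hbq : b ≤ q.1 := by
        by_contra h
        refine hq.2 ⟨⟨hq.1.2, not_le.1 h⟩, ?_⟩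
        exact (W.mem_Ω_iff ((not_le.1 h).trans hbL)).1 hq.1.1
      simp only [hR]
      rw [deriv_boundaryCutoff_of_gt (by linarith)]
      simp
  have hfin : ∫ x in Ioo 0 W.D, F (za, x) = -∫ q in W.truncated za, g q :=
    tendsto_nhds_unique hlim3 (hlim1.neg.congr fun n => (hRn n).symm)
  have hA : ∫ x in Ioo 0 W.D, normalDerivA za u x * φ (za, x)
      = -∫ x in Ioo 0 W.D, F (za, x) := by
    rw [← integral_neg]
    refine setIntegral_congr_fun measurableSet_Ioo fun x hx => ?_
    simp only [hF]
    rw [hu.normalDerivA_eq hza hy hx]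
    ring
  rw [hA, hfin, neg_neg]


variable {x₁ x₂ : ℝ × ℝ} {v χ : ℝ × ℝ → ℂ}

/-! ### Symmetry of the Dirichlet-to-Neumann map -/

theorem continuous_X (W : TerminatingWaveguide) (n : ℕ) : Continuous (W.X n) := by
  unfold X
  fun_prop

theorem memLp_X (W : TerminatingWaveguide) (n : ℕ) (p : ℝ≥0∞) :
    MemLp (fun x => (W.X n x : ℂ)) p (volume.restrict (Ioo 0 W.D)) := by
  refine MemLp.of_bound
    (Complex.continuous_ofReal.comp (W.continuous_X n)).aestronglyMeasurable
    (Real.sqrt (2 / W.D)) (Eventually.of_forall fun x => ?_)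
  rw [Complex.norm_real, Real.norm_eq_abs, X, abs_mul, abs_of_nonneg (Real.sqrt_nonneg _)]
  exact mul_le_of_le_one_right (Real.sqrt_nonneg _) (Real.abs_sin_le_one _)

theorem coeff_eq_setIntegral (W : TerminatingWaveguide) (u : ℝ × ℝ → ℂ) (n : ℕ) (z : ℝ) :
    W.coeff u n z = ∫ x in Ioo 0 W.D, u (z, x) * (W.X n x : ℂ) := by
  rw [coeff, intervalIntegral.integral_of_le W.D_pos.le, integral_Ioc_eq_integral_Ioo]

theorem memLp_modeSum (W : TerminatingWaveguide) (freq za : ℝ) (M N : ℕ) (u : ℝ × ℝ → ℂ) :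
    MemLp (fun x => ∑ n ∈ Finset.Icc 1 N,
      Complex.I * W.β freq M n * W.coeff u n za * (W.X n x : ℂ)) 2
      (volume.restrict (Ioo 0 W.D)) :=
  memLp_finsetSum _ fun n _ => (W.memLp_X n 2).const_mul _

/-- Convergence puts f at finite L² distance from some partial sum, which is bounded. -/
theorem HasDtN.memLp {f : ℝ → ℂ} (h : W.HasDtN freq M za u f)
    (hf : AEStronglyMeasurable f (volume.restrict (Ioo 0 W.D))) :
    MemLp f 2 (volume.restrict (Ioo 0 W.D)) := by
  obtain ⟨N, hN⟩ := (h.2.eventually_lt_const ENNReal.zero_lt_top).exists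
  exact memLp_of_eLpNorm_sub_lt_top hf (W.memLp_modeSum freq za M N u) hN

/-- The series is paired with the trace of u term by term, and the pairing of Xₙ with that trace is
uₙ by definition. -/
theorem HasDtN.tendsto_sum {f : ℝ → ℂ} (hv : W.HasDtN freq M za v f)
    (hf : AEStronglyMeasurable f (volume.restrict (Ioo 0 W.D)))
    (hu : MemLp (fun x : ℝ => u (za, x)) 2 (volume.restrict (Ioo 0 W.D))) :
    Tendsto (fun N => ∑ n ∈ Finset.Icc 1 N,
        Complex.I * W.β freq M n * W.coeff v n za * W.coeff u n za) atTop
      (𝓝 (∫ x in Ioo 0 W.D, f x * u (za, x))) := by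
  have h := tendsto_integral_mul_of_tendsto_eLpNorm hu (hv.memLp hf)
    (fun N => W.memLp_modeSum freq za M N v) hv.2
  simp only [mul_comm (u (za, _))] at h
  refine h.congr fun N => ?_
  simp only [Finset.sum_mul]
  refine (integral_finsetSum _ fun n _ => MemLp.integrable_mul
    ((W.memLp_X n 2).const_mul (Complex.I * W.β freq M n * W.coeff v n za)) hu).trans ?_
  refine Finset.sum_congr rfl fun n _ => ?_
  rw [W.coeff_eq_setIntegral u, ← integral_const_mul]
  congr 1
  funext x
  simp only [Pi.mul_apply]
  ring

/-- Both sides are the limit of ∑ iβₙuₙvₙ, which is symmetric in u and v. Without conjugation it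
does not matter whether βₙ is real or imaginary. -/
theorem HasDtN.integral_mul_comm {f g : ℝ → ℂ} (hu : W.HasDtN freq M za u f)
    (hv : W.HasDtN freq M za v g)
    (hf : AEStronglyMeasurable f (volume.restrict (Ioo 0 W.D)))
    (hg : AEStronglyMeasurable g (volume.restrict (Ioo 0 W.D))) :
    ∫ x in Ioo 0 W.D, g x * u (za, x) = ∫ x in Ioo 0 W.D, f x * v (za, x) := by
  refine tendsto_nhds_unique (hv.tendsto_sum hg hu.1) ((hu.tendsto_sum hf hv.1).congr fun N => ?_)
  exact Finset.sum_congr rfl fun n _ => by ring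

theorem SolvesPointSource.aestronglyMeasurable_normalDerivA
    (hu : W.SolvesPointSource freq M za y u) (hza : za < W.L) (hy : y ∈ W.truncated za) :
    AEStronglyMeasurable (normalDerivA za u) (volume.restrict (Ioo 0 W.D)) := by
  refine ContinuousOn.aestronglyMeasurable ?_ measurableSet_Ioo
  have h : ContinuousOn (fun x => -W.rangeDeriv za y u (za, x)) (Ioo 0 W.D) :=
    (hu.continuousOn_rangeDeriv.comp (by fun_prop)
      fun x hx => mem_truncatedWithA_diff hza hy hx).neg
  exact h.congr fun x hx => hu.normalDerivA_eq hza hy hx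

/-! ### Reciprocity -/

/-- By compactness the support of χ stays at positive distance from the artificial boundary. On the
strip in between, χ vanishes and no source is present, so traces can be controlled there. -/
theorem exists_strip_disjoint_tsupport (hza : za < W.L) (hχ : IsTestFunction (W.truncated za) χ) :
    ∃ b, za < b ∧ b < W.L ∧ ∀ q ∈ tsupport χ, b < q.1 := by
  rcases (tsupport χ).eq_empty_or_nonempty with h | h
  · obtain ⟨b, hb, hbL⟩ := exists_between hza
    exact ⟨b, hb, hbL, by simp [h]⟩
  · obtain ⟨p, hp, hmin⟩ := hχ.2.1.isCompact.exists_isMinOn h continuous_fst.continuousOn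
    obtain ⟨b, hb, hbm⟩ := exists_between (lt_min hza (W.mem_truncated_iff.1 (hχ.2.2 hp)).2)
    exact ⟨b, hb, hbm.trans_le (min_le_left _ _), fun q hq =>
      (hbm.trans_le (min_le_right _ _)).trans_le (hmin hq)⟩

/-- The region outside the two sources where both solutions have finite energy. -/
def sourceFree (W : TerminatingWaveguide) (za r : ℝ) (x₁ x₂ : ℝ × ℝ) : Set (ℝ × ℝ) :=
  W.truncated za \ (Metric.ball x₁ r ∪ Metric.ball x₂ r)

theorem sourceFree_comm : W.sourceFree za r x₁ x₂ = W.sourceFree za r x₂ x₁ := by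
  rw [sourceFree, sourceFree, union_comm]

theorem measurableSet_sourceFree : MeasurableSet (W.sourceFree za r x₁ x₂) :=
  (W.isOpen_truncated za).measurableSet.diff
    (Metric.isOpen_ball.union Metric.isOpen_ball).measurableSet

theorem sourceFree_subset_left : W.sourceFree za r x₁ x₂ ⊆ W.truncated za \ Metric.ball x₁ r :=
  sdiff_subset_sdiff_right subset_union_left

theorem sourceFree_subset_right : W.sourceFree za r x₁ x₂ ⊆ W.truncated za \ Metric.ball x₂ r :=
  sdiff_subset_sdiff_right subset_union_right

theorem strip_subset_sourceFree (hχ1 : ∀ q ∈ Metric.ball x₁ r, χ q = 1)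
    (hχ2 : ∀ q ∈ Metric.ball x₂ r, χ q = 1) {b : ℝ} (hbL : b < W.L)
    (hb : ∀ q ∈ tsupport χ, b < q.1) :
    Ioo za b ×ˢ Ioo 0 W.D ⊆ W.sourceFree za r x₁ x₂ := by
  intro q hq
  refine ⟨⟨(W.mem_Ω_iff (hq.1.2.trans hbL)).2 hq.2, hq.1.1⟩, fun h => ?_⟩
  have h1 : χ q = 1 := h.elim (hχ1 q) (hχ2 q)
  have h2 : q ∈ tsupport χ := subset_tsupport χ (by simp [h1])
  exact absurd (hb q h2) (not_lt.2 hq.1.2.le)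

theorem SolvesPointSource.exists_seq (hu : W.SolvesPointSource freq M za x₁ u) (hr : 0 < r) :
    ∃ φ : ℕ → ℝ × ℝ → ℂ, (∀ n, IsTestFunction W.Ω (φ n)) ∧ ∀ S, S ⊆ W.truncated za \
      Metric.ball x₁ r → Tendsto (fun n => sobolevDistSq S u (φ n)) atTop (𝓝 0) := by
  have h (n : ℕ) := hu.dirichlet r hr ((n : ℝ≥0∞) + 1)⁻¹ (by simp)
  choose φ hφ hlt using h
  refine ⟨φ, hφ, fun S hS => ?_⟩
  have hlim : Tendsto (fun n : ℕ => ((n : ℝ≥0∞) + 1)⁻¹) atTop (𝓝 0) := by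
    have := ENNReal.tendsto_inv_nat_nhds_zero.comp (tendsto_add_atTop_nat 1)
    refine this.congr fun n => ?_
    simp
  exact tendsto_of_tendsto_of_tendsto_of_le_of_le tendsto_const_nhds hlim (fun _ => zero_le)
    fun n => (lintegral_mono_set hS).trans (hlt n).le

/-- Testing the equation of `v` with `u`, cut off near both sources. -/
theorem SolvesPointSource.integral_cutoff_eq (hu : W.SolvesPointSource freq M za x₁ u)
    (hv : W.SolvesPointSource freq M za x₂ v) (hza : za < W.L)
    (hx₂ : x₂ ∈ W.truncated za) (hr : 0 < r)
    (hχ : IsTestFunction (W.truncated za) χ) (hχ1 : ∀ q ∈ Metric.ball x₁ r, χ q = 1)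
    (hχ2 : ∀ q ∈ Metric.ball x₂ r, χ q = 1) :
    (IntegrableOn (fun q => (1 - χ q) * gradDot v u q - u q * gradDot v χ q
        - (W.coefficient freq q : ℂ) * ((1 - χ q) * (v q * u q))) (W.sourceFree za r x₁ x₂)) ∧
    ∫ q in W.sourceFree za r x₁ x₂, ((1 - χ q) * gradDot v u q - u q * gradDot v χ q
        - (W.coefficient freq q : ℂ) * ((1 - χ q) * (v q * u q)))
      = ∫ x in Ioo 0 W.D, normalDerivA za v x * u (za, x) := by
  set S := W.sourceFree za r x₁ x₂ with hS
  have hU := W.isOpen_truncated za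
  have hSU : S ⊆ W.truncated za := sdiff_subset
  obtain ⟨φ, hφ, hlim⟩ := hu.exists_seq hr
  obtain ⟨b, hb, hbL, hbχ⟩ := exists_strip_disjoint_tsupport hza hχ
  have hstrip := strip_subset_sourceFree (za := za) hχ1 hχ2 hbL hbχ
  have hue := (hu.hasFiniteEnergy hr).mono (sourceFree_subset_left (x₂ := x₂))
  have hve := (hv.hasFiniteEnergy hr).mono (sourceFree_subset_right (x₁ := x₁))
  have hφe (n : ℕ) := (hφ n).hasFiniteEnergy S
  have hρc : ContDiff ℝ ∞ fun q => 1 - χ q := contDiff_const.sub hχ.1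
  have hρ : MemLp (fun q => 1 - χ q) ⊤ (volume.restrict S) :=
    (memLp_top_const 1).sub (hχ.memLp ⊤ _)
  -- The left side is linear in u and its first derivatives, with coefficients A₁, A₂, A₀ in L²(S);
  -- it is therefore continuous under H¹ convergence on S.
  set A₁ : ℝ × ℝ → ℂ := fun q => (1 - χ q) * lineDeriv ℝ v q (1, 0)
  set A₂ : ℝ × ℝ → ℂ := fun q => (1 - χ q) * lineDeriv ℝ v q (0, 1)
  set A₀ : ℝ × ℝ → ℂ := fun q => gradDot v χ q + (W.coefficient freq q : ℂ) * ((1 - χ q) * v q)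
  have hA₁ : MemLp A₁ 2 (volume.restrict S) := hve.memLp_lineDeriv_z.mul' hρ
  have hA₂ : MemLp A₂ 2 (volume.restrict S) := hve.memLp_lineDeriv_x.mul' hρ
  have hA₀ : MemLp A₀ 2 (volume.restrict S) := by
    have hρv : MemLp (fun q => (1 - χ q) * v q) 2 (volume.restrict S) := hve.memLp.mul' hρ
    refine MemLp.add (MemLp.add ?_ ?_) ?_
    · exact MemLp.mul' ((hχ.lineDerivative _).memLp ⊤ _) hve.memLp_lineDeriv_z
    · exact MemLp.mul' ((hχ.lineDerivative _).memLp ⊤ _) hve.memLp_lineDeriv_x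
    · exact hρv.mul' ((W.isBoundedCoefficient freq za).memLp_top hU hSU)
  have hsplit {w : ℝ × ℝ → ℂ} (hw : HasFiniteEnergy S w) :
      IntegrableOn (fun q => A₁ q * lineDeriv ℝ w q (1, 0) + A₂ q * lineDeriv ℝ w q (0, 1)
        - A₀ q * w q) S ∧
      ∫ q in S, (A₁ q * lineDeriv ℝ w q (1, 0) + A₂ q * lineDeriv ℝ w q (0, 1) - A₀ q * w q)
        = (∫ q in S, A₁ q * lineDeriv ℝ w q (1, 0)) + (∫ q in S, A₂ q * lineDeriv ℝ w q (0, 1))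
          - ∫ q in S, A₀ q * w q := by
    have i1 := hA₁.integrable_mul hw.memLp_lineDeriv_z
    have i2 := hA₂.integrable_mul hw.memLp_lineDeriv_x
    have i0 := hA₀.integrable_mul hw.memLp
    refine ⟨(i1.add i2).sub i0, ?_⟩
    refine (integral_sub (i1.add i2) i0).trans ?_
    exact congrArg (· - _) (integral_add i1 i2)
  have hfun : (fun q => (1 - χ q) * gradDot v u q - u q * gradDot v χ q
        - (W.coefficient freq q : ℂ) * ((1 - χ q) * (v q * u q)))
      = fun q => A₁ q * lineDeriv ℝ u q (1, 0) + A₂ q * lineDeriv ℝ u q (0, 1) - A₀ q * u q := by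
    funext q
    simp only [A₁, A₂, A₀, gradDot]
    ring
  rw [hfun]
  refine ⟨(hsplit hue).1, ?_⟩
  have hlimS := hlim S sourceFree_subset_left
  have hleft : Tendsto (fun n => ∫ q in S, (A₁ q * lineDeriv ℝ (φ n) q (1, 0)
        + A₂ q * lineDeriv ℝ (φ n) q (0, 1) - A₀ q * φ n q)) atTop
      (𝓝 (∫ q in S, (A₁ q * lineDeriv ℝ u q (1, 0) + A₂ q * lineDeriv ℝ u q (0, 1)
        - A₀ q * u q))) := by
    rw [(hsplit hue).2]
    simp only [fun n => (hsplit (hφe n)).2]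
    exact ((tendsto_integral_mul_of_tendsto_eLpNorm hA₁ hue.memLp_lineDeriv_z
      (fun n => (hφe n).memLp_lineDeriv_z) (tendsto_rpow_half_of_tendsto hlimS
        fun n => eLpNorm_lineDeriv_z_sub_le_sobolevDistSq _ _ _)).add
      (tendsto_integral_mul_of_tendsto_eLpNorm hA₂ hue.memLp_lineDeriv_x
      (fun n => (hφe n).memLp_lineDeriv_x) (tendsto_rpow_half_of_tendsto hlimS
        fun n => eLpNorm_lineDeriv_x_sub_le_sobolevDistSq _ _ _))).sub
      (tendsto_integral_mul_of_tendsto_eLpNorm hA₀ hue.memLp (fun n => (hφe n).memLp)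
        (tendsto_rpow_half_of_tendsto hlimS fun n => eLpNorm_sub_le_sobolevDistSq _ _ _))
  have hvn := hv.radiation.memLp (hv.aestronglyMeasurable_normalDerivA hza hx₂)
  have hright := tendsto_integral_mul_trace hb hvn (w := u) (wn := φ) (fun x hx => by
      refine hu.contDiffOn.comp (contDiff_prodMk_left x).contDiffOn fun z hz => ?_
      refine ⟨⟨(W.mem_Ω_iff (q := (z, x)) (hz.2.trans_lt hbL)).2 hx, hz.1⟩, ?_⟩
      intro h
      have h1 : x₁ ∈ tsupport χ :=
        subset_tsupport χ (by simp [hχ1 x₁ (Metric.mem_ball_self hr)])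
      have h2 := hbχ x₁ h1
      rw [← h] at h2
      exact absurd h2 (not_lt.2 hz.2))
    (fun n => (hφ n).mono (subset_univ _)) (hue.mono hstrip)
    (hlim _ (hstrip.trans sourceFree_subset_left))
  refine tendsto_nhds_unique hleft (hright.congr fun n => ?_)
  -- The factor 1 - χ removes the ball around x₂, where v is singular, and the ball around x₁, where
  -- φₙ need not approximate u.
  have hψ : IsTestFunction W.Ω fun q => (1 - χ q) * φ n q := (hφ n).mul_left hρc
  have hψ0 : ∀ q ∈ Metric.ball x₁ r ∪ Metric.ball x₂ r, (1 - χ q) * φ n q = 0 := fun q hq => by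
    have : χ q = 1 := hq.elim (hχ1 q) (hχ2 q)
    rw [this, sub_self, zero_mul]
  have hw := hv.integral_gradDot_sub hza hx₂ hr hψ fun q hq => hψ0 q (Or.inr hq)
  have htrace : ∫ x in Ioo 0 W.D, normalDerivA za v x * ((1 - χ (za, x)) * φ n (za, x))
      = ∫ x in Ioo 0 W.D, normalDerivA za v x * φ n (za, x) := by
    congr 1
    funext x
    have : χ (za, x) = 0 := hχ.eq_zero fun h => lt_irrefl za (W.mem_truncated_iff.1 h).2
    rw [this, sub_zero, one_mul]
  rw [htrace] at hw
  rw [← hw, setIntegral_eq_of_subset_of_forall_sdiff_eq_zero hU.measurableSet hSU]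
  · refine setIntegral_congr_fun measurableSet_sourceFree fun q _ => ?_
    have hd := gradDot_mul_right (u := v) (hρc.differentiable (by simp) q)
      ((hφ n).contDiff_one.differentiable one_ne_zero q)
    have hρd (e : ℝ × ℝ) : lineDeriv ℝ (fun q => 1 - χ q) q e = -lineDeriv ℝ χ q e := by
      rw [lineDeriv_sub' e (differentiableAt_const 1)
        (hχ.contDiff_one.differentiable one_ne_zero q),
        lineDeriv_of_eventuallyEq_const e (EventuallyEq.refl _ _), zero_sub]
    simp only [hd]
    simp only [A₁, A₂, A₀, gradDot, hρd]
    ring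
  · intro q hq
    have hqb : q ∈ Metric.ball x₁ r ∪ Metric.ball x₂ r := by
      by_contra h
      exact hq.2 ⟨hq.1, h⟩
    have hev : (fun q => (1 - χ q) * φ n q) =ᶠ[𝓝 q] fun _ => 0 := by
      filter_upwards [(Metric.isOpen_ball.union Metric.isOpen_ball).mem_nhds hqb] with p hp
      exact hψ0 p hp
    simp only [gradDot, lineDeriv_of_eventuallyEq_const _ hev, hψ0 q hqb]
    simp

/-- Green's second identity between the two sources. -/
theorem SolvesPointSource.integral_wronskian_eq_zero (hu : W.SolvesPointSource freq M za x₁ u)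
    (hv : W.SolvesPointSource freq M za x₂ v) (hza : za < W.L)
    (hx₁ : x₁ ∈ W.truncated za) (hx₂ : x₂ ∈ W.truncated za) (hr : 0 < r)
    (hχ : IsTestFunction (W.truncated za) χ) (hχ1 : ∀ q ∈ Metric.ball x₁ r, χ q = 1)
    (hχ2 : ∀ q ∈ Metric.ball x₂ r, χ q = 1) :
    ∫ q, (v q * gradDot u χ q - u q * gradDot v χ q) = 0 := by
  obtain ⟨i1, e1⟩ := hu.integral_cutoff_eq hv hza hx₂ hr hχ hχ1 hχ2
  obtain ⟨i2, e2⟩ := hv.integral_cutoff_eq hu hza hx₁ hr hχ hχ2 hχ1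
  rw [sourceFree_comm] at i2 e2
  have hsym := hu.radiation.integral_mul_comm hv.radiation
    (hu.aestronglyMeasurable_normalDerivA hza hx₁) (hv.aestronglyMeasurable_normalDerivA hza hx₂)
  rw [← e1, ← e2, ← sub_eq_zero] at hsym
  -- In the difference of the two identities the terms with 1 - χ are symmetric in u and v and
  -- cancel, including those with κ.
  have h3 := (integral_sub i1 i2).trans hsym
  rw [← setIntegral_eq_integral_of_forall_compl_eq_zero (s := W.sourceFree za r x₁ x₂), ← h3]
  · congr 1
    funext q
    rw [gradDot_comm v u]
    ring
  · intro q hq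
    by_cases hqU : q ∈ W.truncated za
    · have hqb : q ∈ Metric.ball x₁ r ∪ Metric.ball x₂ r := by
        by_contra h
        exact hq ⟨hqU, h⟩
      have hev : χ =ᶠ[𝓝 q] fun _ => 1 := by
        filter_upwards [(Metric.isOpen_ball.union Metric.isOpen_ball).mem_nhds hqb] with p hp
        exact hp.elim (hχ1 p) (hχ2 p)
      simp [gradDot, lineDeriv_of_eventuallyEq_const _ hev]
    · rw [hχ.gradDot_eq_zero hqU, hχ.gradDot_eq_zero hqU]
      simp

/-- The two point values are integrals of v∇u - u∇v against ∇χ₁ and, up to sign, ∇χ₂. Their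
difference is the integral against the gradient of χ₁ + χ₂, which vanishes by Green's identity. -/
theorem SolvesPointSource.reciprocity (hu : W.SolvesPointSource freq M za x₁ u)
    (hv : W.SolvesPointSource freq M za x₂ v) (hza : za < W.L)
    (hx₁ : x₁ ∈ W.truncated za) (hx₂ : x₂ ∈ W.truncated za) (hne : x₁ ≠ x₂) : v x₁ = u x₂ := by
  have hU := W.isOpen_truncated za
  have hκ := W.isBoundedCoefficient freq za
  obtain ⟨R₁, hR₁, hb₁⟩ := Metric.isOpen_iff.1 (hU.sdiff (isClosed_singleton (x := x₂))) x₁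
    ⟨hx₁, hne⟩
  obtain ⟨R₂, hR₂, hb₂⟩ := Metric.isOpen_iff.1 (hU.sdiff (isClosed_singleton (x := x₁))) x₂
    ⟨hx₂, hne.symm⟩
  set d := dist x₁ x₂ with hd
  have hd0 : 0 < d := dist_pos.2 hne
  -- Bounds R₁ and R₂ keep each closed ball of radius s inside the domain and off the other source.
  -- The bound d/2 makes the balls disjoint, so that χ₁ + χ₂ equals 1 near both sources.
  obtain ⟨s, hs, hsm⟩ := exists_between (lt_min (lt_min hR₁ hR₂) (half_pos hd0))
  have hs₁ : s < R₁ := hsm.trans_le ((min_le_left _ _).trans (min_le_left _ _))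
  have hs₂ : s < R₂ := hsm.trans_le ((min_le_left _ _).trans (min_le_right _ _))
  have hsd : s < d / 2 := hsm.trans_le (min_le_right _ _)
  let B (c : ℝ × ℝ) : ContDiffBump c := ⟨s / 2, s, half_pos hs, half_lt_self hs⟩
  let χ (c : ℝ × ℝ) : ℝ × ℝ → ℂ := fun q => (B c q : ℂ)
  have hts (c : ℝ × ℝ) : tsupport (χ c) ⊆ Metric.closedBall c s :=
    (closure_mono fun q hq => by
      intro h
      exact hq (by simp [χ, h])).trans (B c).tsupport_eq.subset
  have htest {V : Set (ℝ × ℝ)} {c : ℝ × ℝ} (hV : Metric.closedBall c s ⊆ V) :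
      IsTestFunction V (χ c) :=
    ⟨Complex.ofRealCLM.contDiff.comp (B c).contDiff,
      (B c).hasCompactSupport.comp_left (g := Complex.ofReal) (by simp), (hts c).trans hV⟩
  have h1 : IsTestFunction (W.truncated za \ {x₂}) (χ x₁) :=
    htest ((Metric.closedBall_subset_ball hs₁).trans hb₁)
  have h2 : IsTestFunction (W.truncated za \ {x₁}) (χ x₂) :=
    htest ((Metric.closedBall_subset_ball hs₂).trans hb₂)
  have hone (c q : ℝ × ℝ) (hq : q ∈ Metric.ball c (s / 2)) : χ c q = 1 := by
    simp only [χ, (B c).one_of_mem_closedBall (Metric.ball_subset_closedBall hq),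
      Complex.ofReal_one]
  have hev (c : ℝ × ℝ) : χ c =ᶠ[𝓝 c] fun _ => 1 := by
    filter_upwards [Metric.ball_mem_nhds c (half_pos hs)] with q hq
    exact hone c q hq
  have hzero {c c' q : ℝ × ℝ} (hcc : d ≤ dist c c') (hq : q ∈ Metric.ball c (s / 2)) :
      χ c' q = 0 := by
    refine image_eq_zero_of_notMem_tsupport fun h => ?_
    have h3 := Metric.mem_closedBall.1 (hts c' h)
    have h4 := Metric.mem_ball.1 hq
    have h5 := dist_triangle_left c c' q
    linarith
  have hsum : IsTestFunction (W.truncated za) fun q => χ x₁ q + χ x₂ q :=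
    ⟨h1.1.add h2.1, h1.2.1.add h2.2.1, (tsupport_add _ _).trans
      (union_subset (h1.mono sdiff_subset).2.2 (h2.mono sdiff_subset).2.2)⟩
  have hW := hu.integral_wronskian_eq_zero hv hza hx₁ hx₂ (half_pos hs) hsum
    (fun q hq => by rw [hone _ q hq, hzero (c := x₁) hd.le hq, add_zero])
    (fun q hq => by rw [hone _ q hq, hzero (c := x₂) (by rw [hd, dist_comm]) hq, zero_add])
  have hpu := hu.isPointSourceSolution
  have hpv := hv.isPointSourceSolution
  have k1 := hpu.eq_integral_gradDot hU hκ hpv h1 (hev x₁)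
  have k2 := hpv.eq_integral_gradDot hU hκ hpu h2 (hev x₂)
  have hgrad (w : ℝ × ℝ → ℂ) (q : ℝ × ℝ) :
      gradDot w (fun q => χ x₁ q + χ x₂ q) q = gradDot w (χ x₁) q + gradDot w (χ x₂) q := by
    simp only [gradDot, lineDeriv_add' _ (h1.contDiff_one.differentiable one_ne_zero q)
      (h2.contDiff_one.differentiable one_ne_zero q)]
    ring
  rw [k1.2, k2.2, ← sub_eq_zero, ← hW]
  refine (integral_sub k1.1 k2.1).symm.trans ?_
  congr 1
  funext q
  rw [hgrad, hgrad]
  ring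

end TerminatingWaveguide

theorem propositionA1 (W : TerminatingWaveguide) (freq za : ℝ) (M : ℕ) (hza : za < W.L)
    (hM : W.μ M < W.k freq ^ 2 ∧ W.k freq ^ 2 < W.μ (M + 1))
    (G : ℝ × ℝ → ℝ × ℝ → ℂ) (hG : W.IsGreensFunction freq M za G) :
    ∀ x₁ ∈ W.truncated za, ∀ x₂ ∈ W.truncated za, G x₁ x₂ = G x₂ x₁ := by
  intro x₁ hx₁ x₂ hx₂
  by_cases hne : x₁ = x₂
  · rw [hne]
  · exact (hG x₁ hx₁).reciprocity (hG x₂ hx₂) hza hx₁ hx₂ hne
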